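/- **Setting.** A net $(P,T,F,\mathsf{read},m_0,\ell)$ has places $P$, transitions $T$, flow arcs $F\subseteq (P\times T)\cup(T\times P)$, read arcs $\mathsf{read}\subseteq P\times T$, an initial marking $m_0:P\to\mathbb N$ and labels $\ell(t)\subseteq\Lambda$. A transition $t$ is enabled at $m:P\to\mathbb N$ if $m(p)>0$ for all $p$ with $(p,t)\in F\cup\mathsf{read}$; firing it removes a token from every place of ${}^\bullet t\setminus t^\bullet$ and adds one to every place of $t^\bullet\setminus{}^\bullet t$. $[m_0\rangle$ is the set of markings reachable from $m_0$ by finite firing sequences. Let $\Sigma_i=(P_i,T_i,F_i,\iota_i,\ell_i)$, $i\in A=\{1,\dots,n\}$, be Petri net agents: 1-safe nets without read arcs, with pairwise disjoint sets of places and pairwise disjoint sets of transitions, in which every transition has a non-empty preset, a non-empty postset and a singleton label. Put $Evt_i=\ell_i(T_i)$ and let $Evt_i^s=Evt_i\cap\bigcup_{j\ne i}Evt_j$ be the set of shared events of agent $i$. For an event $a\in\bigcup_i Evt_i$ let $Rg(a)$ be the set of functions $ST$ on $A$ with $ST(i)\in\ell_i^{-1}(a)$ if $a\in Evt_i$ and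 $ST(i)=\varepsilon$ otherwise; agent $i$ takes part in $ST$ if $ST(i)\ne\varepsilon$. **$\Sigma$ (synchronization on transitions).** Its places are $P=\bigcup_iP_i$, its transitions are all $ST\in Rg(a)$, $a\in\bigcup_iEvt_i$, the flow arcs of $ST$ are those of all its components, and $m_0=\bigcup_i\iota_i$. **$\Sigma'$ (data driven simulation).** The agents taking part in $ST$ are ordered cyclically by their numbers; $\mathrm{prev}(ST,i)$ is the cyclic predecessor of $i$, so that the predecessor of the first (smallest) one is the last (largest) one. Agent $i$ is transformed into a net with read arcs, as follows. - Places: $P_i$, a place $p_i^{sync}$, and, for all $a\in Evt_i^s$, $ST\in Rg(a)$ and $j$ taking part in $ST$, two places $in_{ST,j}$, $out_{ST,j}$, which form an internal binary variable if $j=i$ and an external one if $j\neq i$. - Transitions: all $t\in T_i$ with $\ell_i(t)\notin Evt^s_i$, and $b_{ST,j}$, $e_{ST,j}$ for the same $a,ST,j$ as above. - Flow: the unsplit transitions $t$ keep their arcs and, optionally (for all of them and all agents, or for none), also get a self-loop on $p_i^{sync}$. Each $b_{ST,j}$ moves a token from $in_{ST,j}$ to $out_{ST,j}$ and each $e_{ST,j}$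 moves it back. In addition, $b_{ST,i}$ consumes from ${}^\bullet ST(i)$ and $p_i^{sync}$, and $e_{ST,i}$ produces on $ST(i)^\bullet$ and $p_i^{sync}$. - Read arcs, with $j=\mathrm{prev}(ST,i)$: if $i$ is the first agent of $ST$, then $b_{ST,i}$ reads $in_{ST,j}$ and $e_{ST,i}$ reads $out_{ST,j}$; otherwise $b_{ST,i}$ reads $out_{ST,j}$ and $e_{ST,i}$ reads $in_{ST,j}$. - Initial marking: $\iota_i$ on $P_i$, one token on $p_i^{sync}$ and on every $in_{ST,j}$, no token on $out_{ST,j}$. $\Sigma'$, with initial marking $m_0'$, is the composition of the $n$ transformed agents, added one after the other in an arbitrary order, by fusion of sequential components: every external variable is identified with the internal variable it is a copy of, and a transition that changes an internal variable is fused with the transitions that make the same change in the external copies. For a marking $M$ of $\Sigma$ let $sp(M)$ be the marking of $\Sigma'$ that equals $M$ on $P$, is $1$ on all places $p_i^{sync}$ and $in_{ST,j}$, and $0$ on all places $out_{ST,j}$. **Theorem.** For every marking $M$ of $\Sigma$: $M\in[m_0\rangle$ in $\Sigma$ if and only if $sp(M)\in[m_0'\rangle$ in $\Sigma'$. This holds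 for both versions of the construction, with and without the optional self-loops. -/

import Mathlib

universe u v w x

/-! Petri nets with read arcs -/

/-- A labeled net system with read arcs. The places and the transitions are sets `places`, `trans`
inside ambient types, so that unions and differences of nets can be formed; the remaining data
matter only on these sets. Labels are sets of elements of `Λ`. -/
structure Net (P : Type u) (T : Type v) (Λ : Type w) where
  places : Set P
  trans : Set T
  /-- `pre p t`: there is a flow arc from `p` to `t`. -/
  pre : P → T → Prop
  /-- `post p t`: there is a flow arc from `t` to `p`. -/
  post : P → T → Prop
  /-- `read p t`: there is a read arc between `p` and `t`. -/
  read : P → T → Prop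
  init : P → ℕ
  label : T → Set Λ

namespace Net

variable {P : Type u} {T : Type v} {Λ : Type w}

def preset (N : Net P T Λ) (t : T) : Set P := {p | p ∈ N.places ∧ N.pre p t}

def postset (N : Net P T Λ) (t : T) : Set P := {p | p ∈ N.places ∧ N.post p t}

def activators (N : Net P T Λ) (t : T) : Set P := {p | p ∈ N.places ∧ N.read p t}

/-- A marking assigns a number of tokens to every place of the net. -/
abbrev Marking (N : Net P T Λ) : Type u := N.places → ℕ

/-- The initial marking. -/
def m0 (N : Net P T Λ) : N.Marking := fun p => N.init p

/-- All preconditions and all activators of `t` are marked. -/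
def Enabled (N : Net P T Λ) (m : N.Marking) (t : T) : Prop :=
  t ∈ N.trans ∧ ∀ p : N.places, (N.pre p t ∨ N.read p t) → 0 < m p

/-- `N.Fires m t m'` is `m[t⟩m'`. -/
def Fires (N : Net P T Λ) (m : N.Marking) (t : T) (m' : N.Marking) : Prop :=
  N.Enabled m t ∧ ∀ p : N.places,
    ((N.pre p t ∧ ¬ N.post p t) → m' p = m p - 1) ∧
    ((N.post p t ∧ ¬ N.pre p t) → m' p = m p + 1) ∧
    ((N.pre p t ↔ N.post p t) → m' p = m p)

/-- `m ∈ [m₀⟩`: a finite firing sequence leads from the initial marking to `m`. -/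
def Reachable (N : Net P T Λ) (m : N.Marking) : Prop :=
  Relation.ReflTransGen (fun m₁ m₂ => ∃ t, N.Fires m₁ t m₂) N.m0 m

def OneSafe (N : Net P T Λ) : Prop := ∀ m, N.Reachable m → ∀ p, m p ≤ 1

/-- The alphabet (the set of events) of a net. -/
def alphabet (N : Net P T Λ) : Set (Set Λ) := N.label '' N.trans

/-- A Petri net agent: a 1-safe net system without read arcs, all of whose transitions have a
non-empty preset, a non-empty postset and a singleton label. -/
structure IsAgent (N : Net P T Λ) : Prop where
  no_read : ∀ p ∈ N.places, ∀ t ∈ N.trans, ¬ N.read p t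
  preset_nonempty : ∀ t ∈ N.trans, (N.preset t).Nonempty
  postset_nonempty : ∀ t ∈ N.trans, (N.postset t).Nonempty
  label_singleton : ∀ t ∈ N.trans, ∃ a, N.label t = {a}
  oneSafe : N.OneSafe

/-- The net without places and transitions. -/
def empty : Net P T Λ where
  places := ∅
  trans := ∅
  pre _ _ := False
  post _ _ := False
  read _ _ := False
  init _ := 0
  label _ := ∅

/-! Fusion of sequential components -/

section Fusion

variable {T₁ T₂ : Type v} {I : Type x} {J : Type x}

/-- The places that disappear in the fusion: those of the components `X₂ i = ρ i '' X₁ i` of the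
second net and of the components `X₁' j = ρ' j '' X₂' j` of the first net. -/
def fusedAway (X₁ : I → Set P) (ρ : I → P → P) (X₂' : J → Set P) (ρ' : J → P → P) : Set P :=
  ((⋃ i, ρ i '' X₁ i) \ ⋃ j, X₂' j) ∪ ((⋃ j, ρ' j '' X₂' j) \ ⋃ i, X₁ i)

/-- `FusedName X₁ ρ X₂' ρ' p q`: after the fusion, the place `p` is called `q`. A place that
disappears is identified with the one it corresponds to under the bijections `ρ i`, `ρ' j`. -/
def FusedName (X₁ : I → Set P) (ρ : I → P → P) (X₂' : J → Set P) (ρ' : J → P → P)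
    (p q : P) : Prop :=
  (p ∉ fusedAway X₁ ρ X₂' ρ' ∧ q = p) ∨
  (p ∈ fusedAway X₁ ρ X₂' ρ' ∧
    ((∃ i, q ∈ X₁ i ∧ ρ i q = p) ∨ (∃ j, q ∈ X₂' j ∧ ρ' j q = p)))

/-- The transitions of the second net that are fused with a transition `t₁` of the first net which
moves the token of the components `X₁ i` from `p` to `q`. -/
def partners (N₁ : Net P T₁ Λ) (N₂ : Net P T₂ Λ) (X₁ : I → Set P) (ρ : I → P → P)
    (t₁ : T₁) (p q : P) : Set T₂ :=
  {t₂ | t₂ ∈ N₂.trans ∧ ∃ i, X₁ i ∩ N₁.preset t₁ = {p} ∧ X₁ i ∩ N₁.postset t₁ = {q} ∧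
    ρ i p ∈ N₂.preset t₂ ∧ ρ i q ∈ N₂.postset t₂}

open Classical in
/-- Fusion of sequential components of two nets with disjoint sets of places. The component
`X₁ i` of the first net is identified through `ρ i` with the component `ρ i '' X₁ i` of the second
net and stays; the component `X₂' j` of the second net is identified through `ρ' j` with
the component `ρ' j '' X₂' j` of the first net and stays. The transitions of the fusion are pairs
of sets of transitions. -/
noncomputable def seqFusion (N₁ : Net P T₁ Λ) (N₂ : Net P T₂ Λ)
    (X₁ : I → Set P) (ρ : I → P → P) (X₂' : J → Set P) (ρ' : J → P → P) :
    Net P (Set T₁ × Set T₂) Λ where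
  places := (N₁.places ∪ N₂.places) \ fusedAway X₁ ρ X₂' ρ'
  trans :=
    {U | ∃ t₁ ∈ N₁.trans, ∃ p q, (partners N₁ N₂ X₁ ρ t₁ p q).Nonempty ∧
      U = ({t₁}, partners N₁ N₂ X₁ ρ t₁ p q)} ∪
    {U | ∃ t₂ ∈ N₂.trans, ∃ p q, (partners N₂ N₁ X₂' ρ' t₂ p q).Nonempty ∧
      U = (partners N₂ N₁ X₂' ρ' t₂ p q, {t₂})} ∪
    {U | ∃ t ∈ N₁.trans, U = ({t}, ∅) ∧
      (N₁.preset t ∩ ((⋃ i, X₁ i) ∪ ⋃ j, ρ' j '' X₂' j) = ∅ ∨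
        N₁.postset t ∩ ((⋃ i, X₁ i) ∪ ⋃ j, ρ' j '' X₂' j) = ∅)} ∪
    {U | ∃ t ∈ N₂.trans, U = (∅, {t}) ∧
      (N₂.preset t ∩ ((⋃ i, ρ i '' X₁ i) ∪ ⋃ j, X₂' j) = ∅ ∨
        N₂.postset t ∩ ((⋃ i, ρ i '' X₁ i) ∪ ⋃ j, X₂' j) = ∅)}
  pre q U := ∃ p, FusedName X₁ ρ X₂' ρ' p q ∧
    ((∃ t ∈ U.1, p ∈ N₁.preset t) ∨ (∃ t ∈ U.2, p ∈ N₂.preset t))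
  post q U := ∃ p, FusedName X₁ ρ X₂' ρ' p q ∧
    ((∃ t ∈ U.1, p ∈ N₁.postset t) ∨ (∃ t ∈ U.2, p ∈ N₂.postset t))
  read q U := ∃ p, FusedName X₁ ρ X₂' ρ' p q ∧
    ((∃ t ∈ U.1, p ∈ N₁.activators t) ∨ (∃ t ∈ U.2, p ∈ N₂.activators t))
  init p := if p ∈ N₁.places then N₁.init p else N₂.init p
  label U := (⋃ t ∈ U.1, N₁.label t) ∪ ⋃ t ∈ U.2, N₂.label t

end Fusion

end Net

/-! Multi-agent systems: agents are numbered by `Fin n` -/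

namespace MAS

variable {n : ℕ} {P : Fin n → Type u} {T : Fin n → Type v} {Λ : Type w}

/-- A choice of at most one transition of every agent; `none` plays the role of `ε`. -/
abbrev Vec (T : Fin n → Type v) : Type v := (i : Fin n) → Option (T i)

/-- All combinations of transitions labeled with the event `a`, exactly one from every agent that
has `a` in its alphabet and none from the other agents. -/
def Rg (N : (i : Fin n) → Net (P i) (T i) Λ) (a : Set Λ) : Set (Vec T) :=
  {S | ∀ i, (a ∈ (N i).alphabet → ∃ t ∈ (N i).trans, (N i).label t = a ∧ S i = some t) ∧
    (a ∉ (N i).alphabet → S i = none)}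

/-- The events that agent `i` shares with another agent. -/
def sharedEvents (N : (i : Fin n) → Net (P i) (T i) Λ) (i : Fin n) : Set (Set Λ) :=
  {a | a ∈ (N i).alphabet ∧ ∃ j, j ≠ i ∧ a ∈ (N j).alphabet}

/-- Synchronization on transitions: the action based composition of the agents. -/
def actComp (N : (i : Fin n) → Net (P i) (T i) Λ) : Net (Σ i, P i) (Vec T) Λ where
  places := {p | p.2 ∈ (N p.1).places}
  trans := {S | ∃ a, (∃ i, a ∈ (N i).alphabet) ∧ S ∈ Rg N a}
  pre p S := ∃ t, S p.1 = some t ∧ (N p.1).pre p.2 t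
  post p S := ∃ t, S p.1 = some t ∧ (N p.1).post p.2 t
  read p S := ∃ t, S p.1 = some t ∧ (N p.1).read p.2 t
  init p := (N p.1).init p.2
  label S := {a | ∃ i, ∃ t, S i = some t ∧ a ∈ (N i).label t}

/-- `i` is the smallest agent taking part in `S`. -/
def IsFirst (S : Vec T) (i : Fin n) : Prop := S i ≠ none ∧ ∀ k, S k ≠ none → i ≤ k

/-- `j` is the agent preceding `i` in the cyclic order of the agents taking part in `S`: the largest
`j < i` taking part in `S` if there is one, otherwise the largest agent taking part in `S`. -/
def IsPrev (S : Vec T) (i j : Fin n) : Prop :=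
  S j ≠ none ∧
  ((j < i ∧ ∀ k, k < i → S k ≠ none → k ≤ j) ∨
    ((∀ k, k < i → S k = none) ∧ ∀ k, S k ≠ none → k ≤ j))

/-- The places of the transformed agents. `inn k S j`, `out k S j` are the two values of the binary
variable that tells whether agent `j` is in the middle of its part of the synchronization `S`, in
the copy that belongs to the transformed agent `k`: an internal variable if `k = j`, an external one
if `k ≠ j`. -/
inductive DPlace (P : Fin n → Type u) (T : Fin n → Type v) : Type (max u v)
  | base (i : Fin n) (p : P i)
  | sync (i : Fin n)
  | inn (k : Fin n) (S : Vec T) (j : Fin n)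
  | out (k : Fin n) (S : Vec T) (j : Fin n)

/-- The transitions of the transformed agents: unsplit ones, and beginnings and ends of the part of
agent `j` in the synchronization `S`, as seen by the transformed agent `k`. -/
inductive DTrans (T : Fin n → Type v) : Type v
  | unique (i : Fin n) (t : T i)
  | beg (k : Fin n) (S : Vec T) (j : Fin n)
  | fin (k : Fin n) (S : Vec T) (j : Fin n)

/-- `S` is a combination of transitions labeled with an event that `k` shares with another agent,
and `j` takes part in it. -/
def HasVar (N : (i : Fin n) → Net (P i) (T i) Λ) (k : Fin n) (S : Vec T) (j : Fin n) : Prop :=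
  (∃ a ∈ sharedEvents N k, S ∈ Rg N a) ∧ S j ≠ none

/-- The places of the transformed agent `k`. -/
def modPlaces (N : (i : Fin n) → Net (P i) (T i) Λ) (k : Fin n) : DPlace P T → Prop
  | .base i p => i = k ∧ p ∈ (N i).places
  | .sync i => i = k
  | .inn k' S j => k' = k ∧ HasVar N k S j
  | .out k' S j => k' = k ∧ HasVar N k S j

/-- The transitions of the transformed agent `k`. -/
def modTrans (N : (i : Fin n) → Net (P i) (T i) Λ) (k : Fin n) : DTrans T → Prop
  | .unique i t => i = k ∧ t ∈ (N i).trans ∧ (N i).label t ∉ sharedEvents N i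
  | .beg k' S j => k' = k ∧ HasVar N k S j
  | .fin k' S j => k' = k ∧ HasVar N k S j

/-- Flow arcs from places to transitions in the transformed agent `k`. If `loops` holds, the unsplit
transitions have self-loops on the synchronization place. -/
inductive ModPre (N : (i : Fin n) → Net (P i) (T i) Λ) (loops : Prop) (k : Fin n) :
    DPlace P T → DTrans T → Prop
  | unique (p : P k) (t : T k) : (N k).pre p t → ModPre N loops k (.base k p) (.unique k t)
  | uniqueSync (t : T k) : loops → ModPre N loops k (.sync k) (.unique k t)
  | begBase (p : P k) (S : Vec T) (t : T k) : S k = some t → (N k).pre p t →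
      ModPre N loops k (.base k p) (.beg k S k)
  | begSync (S : Vec T) : ModPre N loops k (.sync k) (.beg k S k)
  | begInn (S : Vec T) (j : Fin n) : ModPre N loops k (.inn k S j) (.beg k S j)
  | finOut (S : Vec T) (j : Fin n) : ModPre N loops k (.out k S j) (.fin k S j)

/-- Flow arcs from transitions to places in the transformed agent `k`. -/
inductive ModPost (N : (i : Fin n) → Net (P i) (T i) Λ) (loops : Prop) (k : Fin n) :
    DPlace P T → DTrans T → Prop
  | unique (p : P k) (t : T k) : (N k).post p t → ModPost N loops k (.base k p) (.unique k t)
  | uniqueSync (t : T k) : loops → ModPost N loops k (.sync k) (.unique k t)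
  | finBase (p : P k) (S : Vec T) (t : T k) : S k = some t → (N k).post p t →
      ModPost N loops k (.base k p) (.fin k S k)
  | finSync (S : Vec T) : ModPost N loops k (.sync k) (.fin k S k)
  | begOut (S : Vec T) (j : Fin n) : ModPost N loops k (.out k S j) (.beg k S j)
  | finInn (S : Vec T) (j : Fin n) : ModPost N loops k (.inn k S j) (.fin k S j)

/-- Read arcs in the transformed agent `k`. The first agent of a synchronization begins when the
last one is not busy with it and ends when the last one is; any other agent begins when its
predecessor is busy with the synchronization and ends when its predecessor no longer is. -/
inductive ModRead (k : Fin n) : DPlace P T → DTrans T → Prop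
  | begFirst (S : Vec T) (j : Fin n) : IsFirst S k → IsPrev S k j →
      ModRead k (.inn k S j) (.beg k S k)
  | finFirst (S : Vec T) (j : Fin n) : IsFirst S k → IsPrev S k j →
      ModRead k (.out k S j) (.fin k S k)
  | begOther (S : Vec T) (j : Fin n) : ¬ IsFirst S k → IsPrev S k j →
      ModRead k (.out k S j) (.beg k S k)
  | finOther (S : Vec T) (j : Fin n) : ¬ IsFirst S k → IsPrev S k j →
      ModRead k (.inn k S j) (.fin k S k)

/-- Initial marking of the transformed agents. -/
def modInit (N : (i : Fin n) → Net (P i) (T i) Λ) : DPlace P T → ℕ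
  | .base i p => (N i).init p
  | .sync _ => 1
  | .inn _ _ _ => 1
  | .out _ _ _ => 0

/-- Labels of the transformed agents; transitions of external variables have the empty label. -/
def modLabel (N : (i : Fin n) → Net (P i) (T i) Λ) : DTrans T → Set Λ
  | .unique i t => (N i).label t
  | .beg k S j => {a | j = k ∧ ∃ t, S k = some t ∧ a ∈ (N k).label t}
  | .fin k S j => {a | j = k ∧ ∃ t, S k = some t ∧ a ∈ (N k).label t}

/-- The transformed agent `k`: a net with read arcs, internal and external binary variables. -/
def modNet (N : (i : Fin n) → Net (P i) (T i) Λ) (loops : Prop) (k : Fin n) :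
    Net (DPlace P T) (DTrans T) Λ where
  places := {p | modPlaces N k p}
  trans := {t | modTrans N k t}
  pre := ModPre N loops k
  post := ModPost N loops k
  read := ModRead k
  init := modInit N
  label := modLabel N

/-- The external variables of a net with places `B` that are internal variables of a net with
places `A`: triples `(k, S, j)` such that the variable of agent `j` for the synchronization `S` is
internal in `A` and its copy for agent `k ≠ j` is present in `B`. -/
abbrev SharedVar (A B : Set (DPlace P T)) : Type v :=
  {y : Fin n × Vec T × Fin n // y.1 ≠ y.2.2 ∧
    DPlace.inn y.2.2 y.2.1 y.2.2 ∈ A ∧ DPlace.inn y.1 y.2.1 y.2.2 ∈ B}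

/-- The sequential component formed by the internal variable. -/
def varComp {A B : Set (DPlace P T)} (y : SharedVar A B) : Set (DPlace P T) :=
  {DPlace.inn y.1.2.2 y.1.2.1 y.1.2.2, DPlace.out y.1.2.2 y.1.2.1 y.1.2.2}

/-- The bijection from the component of the internal variable to that of its external copy. -/
def varMap {A B : Set (DPlace P T)} (y : SharedVar A B) : DPlace P T → DPlace P T
  | .inn _ S j => .inn y.1.1 S j
  | .out _ S j => .out y.1.1 S j
  | p => p

/-- The type of the transitions of the net that arises from fusing the transformed agents of a
list one after the other. -/
def FTrans (T : Fin n → Type v) : List (Fin n) → Type v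
  | [] => PEmpty
  | _ :: l => Set (FTrans T l) × Set (DTrans T)

/-- The data driven composition of the transformed agents of a list: they are added one after the
other, starting with the last one, by fusion of the sequential components that are internal
variables on one side and external variables on the other side. -/
noncomputable def dataComp (N : (i : Fin n) → Net (P i) (T i) Λ) (loops : Prop) :
    (l : List (Fin n)) → Net (DPlace P T) (FTrans T l) Λ
  | [] => Net.empty
  | k :: l =>
    Net.seqFusion (dataComp N loops l) (modNet N loops k)
      (varComp (A := (dataComp N loops l).places) (B := (modNet N loops k).places)) varMap
      (varComp (A := (modNet N loops k).places) (B := (dataComp N loops l).places)) varMap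

theorem base_mem_places (N : (i : Fin n) → Net (P i) (T i) Λ) (loops : Prop)
    (l : List (Fin n)) (i : Fin n) (p : P i)
    (h : DPlace.base i p ∈ (dataComp N loops l).places) : p ∈ (N i).places := by
  induction l with
  | nil => exact h.elim
  | cons k l ih => exact h.1.elim ih fun h => h.2

/-- The marking of the data driven composition that corresponds to a marking `M` of the action
based composition: the same on the original places, no agent is busy and no synchronization is
going on. -/
def sp (N : (i : Fin n) → Net (P i) (T i) Λ) (loops : Prop) (l : List (Fin n))
    (M : (actComp N).Marking) : (dataComp N loops l).Marking
  | ⟨.base i p, h⟩ => M ⟨⟨i, p⟩, base_mem_places N loops l i p h⟩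
  | ⟨.sync _, _⟩ => 1
  | ⟨.inn _ _ _, _⟩ => 1
  | ⟨.out _ _ _, _⟩ => 0

end MAS

/-! The mathematical content is a two-phase protocol. During one run of a synchronization $S$ the
read arcs make its agents begin in increasing order, and the first agent may end only when the last
one is busy, hence when all are. The ends then follow in the same order. The first end is the commit
point: before it the busy agents form an initial segment of the agents of $S$, and the others have
done nothing yet. After it they form a final segment, and the others have ended.

From $\Sigma$ to $\Sigma'$ (`reachable_sp`): an occurrence of $S$ is unfolded into all beginnings
followed by all ends, both in increasing order. The intermediate markings `midway` are explicit, and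
`midway_begin` and `midway_end` check each move. An unsplit transition is simulated by itself.

From $\Sigma'$ to $\Sigma$ (`reachable_of_reachable_sp`): different synchronizations and unsplit
transitions may interleave, so a run cannot simply be read backwards. Instead every reachable
marking of $\Sigma'$ is mapped to a marking of $\Sigma$ by completing the committed parts and
undoing the uncommitted ones (`abstraction`). The invariant `Tracks` records what each agent is busy
with, and the two segment properties. A beginning leaves the abstraction unchanged (`Tracks.begin`),
the committing end fires $S$ and any other end changes nothing (`Tracks.finish`), and an unsplit
transition fires as itself (`Tracks.unique`). At $sp(M)$ nobody is busy, so the abstraction is $M$.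

All this needs the flow and read arcs of $\Sigma'$, which is defined by iterated fusion.
`describes_dataComp` computes them by induction on the list of agents: every transition of the
composition has the arcs of one transition of one transformed agent, up to renaming external copies
into internal variables in its read arcs. The reason is that a move of an external copy has no arcs
besides those of the copy, so fusing it with the internal move adds nothing. The order of the agents
therefore does not matter in the end, and `exists_fires_iff_moves` describes firing in $\Sigma'$
without reference to fusion. -/

namespace MAS

variable {n : ℕ} {P : Fin n → Type u} {T : Fin n → Type v} {Λ : Type w}

/-! ### Binary variables and shared synchronizations -/

/-- The two values of a binary variable: `inn` for `false` and `out` for `true`. -/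
def val (b : Bool) (k : Fin n) (S : Vec T) (j : Fin n) : DPlace P T :=
  match b with
  | false => .inn k S j
  | true => .out k S j

/-- The transition that moves a binary variable away from the value `b`. -/
def mv (b : Bool) (k : Fin n) (S : Vec T) (j : Fin n) : DTrans T :=
  match b with
  | false => .beg k S j
  | true => .fin k S j

/-- The agent to whose transformed net a transition belongs. -/
def owner : DTrans T → Fin n
  | .unique i _ => i
  | .beg k _ _ => k
  | .fin k _ _ => k

@[simp] theorem owner_unique (i : Fin n) (t : T i) : owner (.unique i t) = i := rfl

@[simp] theorem owner_mv (b : Bool) (k : Fin n) (S : Vec T) (j : Fin n) :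
    owner (mv b k S j) = k := by cases b <;> rfl

@[simp] theorem val_inj {b b' : Bool} {k k' : Fin n} {S S' : Vec T} {j j' : Fin n} :
    (val b k S j : DPlace P T) = val b' k' S' j' ↔ b = b' ∧ k = k' ∧ S = S' ∧ j = j' := by
  cases b <;> cases b' <;> simp [val]

@[simp] theorem mv_inj {b b' : Bool} {k k' : Fin n} {S S' : Vec T} {j j' : Fin n} :
    (mv b k S j : DTrans T) = mv b' k' S' j' ↔ b = b' ∧ k = k' ∧ S = S' ∧ j = j' := by
  cases b <;> cases b' <;> simp [mv]

@[simp] theorem base_ne_val {i : Fin n} {p : P i} {b : Bool} {k : Fin n} {S : Vec T} {j : Fin n} :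
    (DPlace.base i p : DPlace P T) ≠ val b k S j := by cases b <;> simp [val]

@[simp] theorem sync_ne_val {i : Fin n} {b : Bool} {k : Fin n} {S : Vec T} {j : Fin n} :
    (DPlace.sync i : DPlace P T) ≠ val b k S j := by cases b <;> simp [val]

@[simp] theorem unique_ne_mv {i : Fin n} {t : T i} {b : Bool} {k : Fin n} {S : Vec T}
    {j : Fin n} : (DTrans.unique i t : DTrans T) ≠ mv b k S j := by cases b <;> simp [mv]

@[elab_as_elim]
theorem place_cases {motive : DPlace P T → Prop} (base : ∀ i p, motive (.base i p))
    (sync : ∀ i, motive (.sync i)) (var : ∀ b k S j, motive (val b k S j))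
    (p : DPlace P T) : motive p := by
  cases p with
  | base i p => exact base i p
  | sync i => exact sync i
  | inn k S j => exact var false k S j
  | out k S j => exact var true k S j

@[elab_as_elim]
theorem trans_cases {motive : DTrans T → Prop} (unique : ∀ i t, motive (.unique i t))
    (move : ∀ b k S j, motive (mv b k S j)) (t : DTrans T) : motive t := by
  cases t with
  | unique i t => exact unique i t
  | beg k S j => exact move false k S j
  | fin k S j => exact move true k S j

/-- `S` is a synchronization of at least two agents. -/
def IsShared (N : (i : Fin n) → Net (P i) (T i) Λ) (S : Vec T) : Prop :=
  ∃ a, S ∈ Rg N a ∧ ∃ i j, i ≠ j ∧ a ∈ (N i).alphabet ∧ a ∈ (N j).alphabet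

theorem ne_none_iff_mem_alphabet {N : (i : Fin n) → Net (P i) (T i) Λ} {S : Vec T} {a : Set Λ}
    (hS : S ∈ Rg N a) (i : Fin n) : S i ≠ none ↔ a ∈ (N i).alphabet := by
  constructor
  · intro h
    by_contra h'
    exact h ((hS i).2 h')
  · intro h h'
    obtain ⟨t, -, -, ht⟩ := (hS i).1 h
    simp [ht] at h'

/-- Of two distinct agents that share the event, at least one differs from `k`, so being shared is a
property of `S` alone. In this symmetric form, a copy held by `k` forces the internal original at
`j` to exist. -/
theorem hasVar_iff {N : (i : Fin n) → Net (P i) (T i) Λ} {k : Fin n} {S : Vec T} {j : Fin n} :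
    HasVar N k S j ↔ IsShared N S ∧ S k ≠ none ∧ S j ≠ none := by
  constructor
  · rintro ⟨⟨a, ⟨hk, i, hi, hi'⟩, hS⟩, hj⟩
    exact ⟨⟨a, hS, i, k, hi, hi', hk⟩, (ne_none_iff_mem_alphabet hS k).2 hk, hj⟩
  · rintro ⟨⟨a, hS, i, i', hne, hi, hi'⟩, hk, hj⟩
    refine ⟨⟨a, ⟨(ne_none_iff_mem_alphabet hS k).1 hk, ?_⟩, hS⟩, hj⟩
    by_cases h : i = k
    · exact ⟨i', fun h' => hne (h.trans h'.symm), hi'⟩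
    · exact ⟨i, h, hi⟩

/-! ### Arcs at the variables of a single transformed agent -/

section Local

variable {N : (i : Fin n) → Net (P i) (T i) Λ} {loops : Prop}

@[simp] theorem base_mem_modNet {k i : Fin n} {p : P i} :
    DPlace.base i p ∈ (modNet N loops k).places ↔ i = k ∧ p ∈ (N i).places := Iff.rfl

@[simp] theorem sync_mem_modNet {k i : Fin n} :
    (DPlace.sync i : DPlace P T) ∈ (modNet N loops k).places ↔ i = k := Iff.rfl

@[simp] theorem val_mem_modNet {b : Bool} {k k' : Fin n} {S : Vec T} {j : Fin n} :
    (val b k' S j : DPlace P T) ∈ (modNet N loops k).places ↔ k' = k ∧ HasVar N k S j := by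
  cases b <;> exact Iff.rfl

@[simp] theorem unique_mem_modNet {k i : Fin n} {t : T i} :
    DTrans.unique i t ∈ (modNet N loops k).trans ↔
      i = k ∧ t ∈ (N i).trans ∧ (N i).label t ∉ sharedEvents N i := Iff.rfl

@[simp] theorem mv_mem_modNet {b : Bool} {k k' : Fin n} {S : Vec T} {j : Fin n} :
    mv b k' S j ∈ (modNet N loops k).trans ↔ k' = k ∧ HasVar N k S j := by
  cases b <;> exact Iff.rfl

theorem modPre_val {b : Bool} {k k' : Fin n} {S : Vec T} {j : Fin n} {t : DTrans T} :
    ModPre N loops k (val b k' S j) t ↔ k' = k ∧ t = mv b k S j := by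
  constructor
  · cases b <;> rintro ⟨⟩ <;> exact ⟨rfl, rfl⟩
  · rintro ⟨rfl, rfl⟩
    cases b <;> constructor

/-- The value is written `!b` because `mv b` takes the variable from `b` to `!b`. Both sides of one
move are thus expressed through the same `b`. -/
theorem modPost_val {b : Bool} {k k' : Fin n} {S : Vec T} {j : Fin n} {t : DTrans T} :
    ModPost N loops k (val (!b) k' S j) t ↔ k' = k ∧ t = mv b k S j := by
  constructor
  · cases b <;> rintro ⟨⟩ <;> exact ⟨rfl, rfl⟩
  · rintro ⟨rfl, rfl⟩
    cases b <;> constructor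

theorem val_mem_preset {b : Bool} {k k' : Fin n} {S : Vec T} {j : Fin n} {t : DTrans T} :
    (val b k' S j : DPlace P T) ∈ (modNet N loops k).preset t ↔
      k' = k ∧ HasVar N k S j ∧ t = mv b k S j := by
  change _ ∈ (modNet N loops k).places ∧ ModPre N loops k _ t ↔ _
  rw [val_mem_modNet, modPre_val]
  tauto

theorem val_mem_postset {b : Bool} {k k' : Fin n} {S : Vec T} {j : Fin n} {t : DTrans T} :
    (val (!b) k' S j : DPlace P T) ∈ (modNet N loops k).postset t ↔
      k' = k ∧ HasVar N k S j ∧ t = mv b k S j := by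
  change _ ∈ (modNet N loops k).places ∧ ModPost N loops k _ t ↔ _
  rw [val_mem_modNet, modPost_val]
  tauto

/-- Moves of external copies touch the copy and nothing else. With `postset_external` and
`activators_external`, this is why fusion with such a move contributes no new arc. -/
theorem preset_external {b : Bool} {k : Fin n} {S : Vec T} {j : Fin n} (hj : j ≠ k)
    (h : HasVar N k S j) : (modNet N loops k).preset (mv b k S j) = {val b k S j} := by
  ext p
  induction p using place_cases with
  | base i p =>
    simp only [Set.mem_singleton_iff, base_ne_val, iff_false]
    rintro ⟨-, h⟩
    cases b <;> cases h
    exact hj rfl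
  | sync i =>
    simp only [Set.mem_singleton_iff, sync_ne_val, iff_false]
    rintro ⟨-, h⟩
    cases b <;> cases h
    exact hj rfl
  | var b' k' S' j' =>
    rw [val_mem_preset]
    simp only [Set.mem_singleton_iff, val_inj, mv_inj]
    grind

theorem postset_external {b : Bool} {k : Fin n} {S : Vec T} {j : Fin n} (hj : j ≠ k)
    (h : HasVar N k S j) : (modNet N loops k).postset (mv b k S j) = {val (!b) k S j} := by
  ext p
  induction p using place_cases with
  | base i p =>
    simp only [Set.mem_singleton_iff, base_ne_val, iff_false]
    rintro ⟨-, h⟩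
    cases b <;> cases h
    exact hj rfl
  | sync i =>
    simp only [Set.mem_singleton_iff, sync_ne_val, iff_false]
    rintro ⟨-, h⟩
    cases b <;> cases h
    exact hj rfl
  | var b' k' S' j' =>
    obtain ⟨c, rfl⟩ : ∃ c, b' = !c := ⟨!b', by simp⟩
    rw [val_mem_postset]
    simp only [Set.mem_singleton_iff, val_inj, mv_inj]
    grind

theorem activators_external {b : Bool} {k : Fin n} {S : Vec T} {j : Fin n} (hj : j ≠ k) :
    (modNet N loops k).activators (mv b k S j) = ∅ := by
  ext p
  simp only [Set.mem_empty_iff_false, iff_false]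
  rintro ⟨-, h⟩
  cases b <;> cases h <;> exact hj rfl

end Local

/-! ### Explicit description of a partial composition -/

/-- The name of a place after all agents in `l` have been fused. -/
def rename (l : List (Fin n)) : DPlace P T → DPlace P T
  | .inn k S j => if j ∈ l then .inn j S j else .inn k S j
  | .out k S j => if j ∈ l then .out j S j else .out k S j
  | p => p

@[simp] theorem rename_base (l : List (Fin n)) (i : Fin n) (p : P i) :
    rename l (DPlace.base i p : DPlace P T) = .base i p := rfl

@[simp] theorem rename_sync (l : List (Fin n)) (i : Fin n) :
    rename l (DPlace.sync i : DPlace P T) = .sync i := rfl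

theorem rename_val (l : List (Fin n)) (b : Bool) (k : Fin n) (S : Vec T) (j : Fin n) :
    rename l (val b k S j : DPlace P T) = if j ∈ l then val b j S j else val b k S j := by
  cases b <;> rfl

/-- The places of the composition of the agents in `l`. -/
def IsPlace (N : (i : Fin n) → Net (P i) (T i) Λ) (l : List (Fin n)) : DPlace P T → Prop
  | .base i p => i ∈ l ∧ p ∈ (N i).places
  | .sync i => i ∈ l
  | .inn k S j => k ∈ l ∧ HasVar N k S j ∧ (k = j ∨ j ∉ l)
  | .out k S j => k ∈ l ∧ HasVar N k S j ∧ (k = j ∨ j ∉ l)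

theorem isPlace_val {N : (i : Fin n) → Net (P i) (T i) Λ} {l : List (Fin n)} {b : Bool}
    {k : Fin n} {S : Vec T} {j : Fin n} :
    IsPlace N l (val b k S j) ↔ k ∈ l ∧ HasVar N k S j ∧ (k = j ∨ j ∉ l) := by
  cases b <;> exact Iff.rfl

/-- The transitions of the transformed agents that represent those of the composition of the
agents in `l`: a change of a variable is represented by the one of the internal variable as soon as
this variable is present. -/
def IsRepr (N : (i : Fin n) → Net (P i) (T i) Λ) (l : List (Fin n)) : DTrans T → Prop
  | .unique i t => i ∈ l ∧ t ∈ (N i).trans ∧ (N i).label t ∉ sharedEvents N i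
  | .beg k S j => k ∈ l ∧ HasVar N k S j ∧ (k = j ∨ j ∉ l)
  | .fin k S j => k ∈ l ∧ HasVar N k S j ∧ (k = j ∨ j ∉ l)

theorem isRepr_mv {N : (i : Fin n) → Net (P i) (T i) Λ} {l : List (Fin n)} {b : Bool}
    {k : Fin n} {S : Vec T} {j : Fin n} :
    IsRepr N l (mv b k S j) ↔ k ∈ l ∧ HasVar N k S j ∧ (k = j ∨ j ∉ l) := by
  cases b <;> exact Iff.rfl

/-- The transition `t` of the composition of the agents in `l` has the arcs of `r`. -/
structure Represents (N : (i : Fin n) → Net (P i) (T i) Λ) (loops : Prop) (l : List (Fin n))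
    (t : FTrans T l) (r : DTrans T) : Prop where
  preset : (dataComp N loops l).preset t = (modNet N loops (owner r)).preset r
  postset : (dataComp N loops l).postset t = (modNet N loops (owner r)).postset r
  activators : (dataComp N loops l).activators t =
    rename l '' (modNet N loops (owner r)).activators r

/-- An explicit description of the composition of the agents in `l`. -/
structure Describes (N : (i : Fin n) → Net (P i) (T i) Λ) (loops : Prop)
    (l : List (Fin n)) : Prop where
  places : ∀ p, p ∈ (dataComp N loops l).places ↔ IsPlace N l p
  init : ∀ p ∈ (dataComp N loops l).places, (dataComp N loops l).init p = modInit N p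
  classify : ∀ t ∈ (dataComp N loops l).trans, ∃ r, IsRepr N l r ∧ Represents N loops l t r
  realize : ∀ r, IsRepr N l r → ∃ t ∈ (dataComp N loops l).trans, Represents N loops l t r

/-! ### Shared variables and fusion partners -/

section SharedVar

variable {A B : Set (DPlace P T)}

theorem mem_varComp {y : SharedVar A B} {p : DPlace P T} :
    p ∈ varComp y ↔ ∃ b, p = val b y.1.2.2 y.1.2.1 y.1.2.2 := by
  simp [varComp, val]

theorem varMap_val (y : SharedVar A B) (b : Bool) (k : Fin n) (S : Vec T) (j : Fin n) :
    varMap y (val b k S j) = val b y.1.1 S j := by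
  cases b <;> rfl

theorem mem_iUnion_varComp {p : DPlace P T} :
    p ∈ ⋃ y : SharedVar A B, varComp y ↔
      ∃ b k S j, p = val b j S j ∧ k ≠ j ∧ val false j S j ∈ A ∧ val false k S j ∈ B := by
  simp only [Set.mem_iUnion, mem_varComp]
  constructor
  · rintro ⟨y, b, rfl⟩
    exact ⟨b, _, _, _, rfl, y.2⟩
  · rintro ⟨b, k, S, j, rfl, h⟩
    exact ⟨⟨(k, S, j), h⟩, b, rfl⟩

theorem mem_iUnion_varMap {p : DPlace P T} :
    p ∈ ⋃ y : SharedVar A B, varMap y '' varComp y ↔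
      ∃ b k S j, p = val b k S j ∧ k ≠ j ∧ val false j S j ∈ A ∧ val false k S j ∈ B := by
  simp only [Set.mem_iUnion, Set.mem_image, mem_varComp]
  constructor
  · rintro ⟨y, _, ⟨b, rfl⟩, rfl⟩
    exact ⟨b, _, _, _, varMap_val y b _ _ _, y.2⟩
  · rintro ⟨b, k, S, j, rfl, h⟩
    exact ⟨⟨(k, S, j), h⟩, _, ⟨b, rfl⟩, varMap_val _ b _ _ _⟩

theorem exists_varMap_eq {p q : DPlace P T} :
    (∃ y : SharedVar A B, q ∈ varComp y ∧ varMap y q = p) ↔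
      ∃ b k S j, q = val b j S j ∧ p = val b k S j ∧ k ≠ j ∧ val false j S j ∈ A ∧
        val false k S j ∈ B := by
  simp only [mem_varComp]
  constructor
  · rintro ⟨y, ⟨b, rfl⟩, rfl⟩
    exact ⟨b, _, _, _, rfl, varMap_val y b _ _ _, y.2⟩
  · rintro ⟨b, k, S, j, rfl, rfl, h⟩
    exact ⟨⟨(k, S, j), h⟩, ⟨b, rfl⟩, varMap_val _ b _ _ _⟩

/-- Intersecting a two-place component in exactly one place means containing the value `d` for
exactly one Boolean `d`. This turns the set equations in the definition of partners into conditions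
on Booleans. -/
theorem mem_partners {T₁ T₂ : Type v} {N₁ : Net (DPlace P T) T₁ Λ} {N₂ : Net (DPlace P T) T₂ Λ}
    {t₁ : T₁} {t₂ : T₂} {p q : DPlace P T} :
    t₂ ∈ Net.partners N₁ N₂ (varComp (A := A) (B := B)) varMap t₁ p q ↔
      t₂ ∈ N₂.trans ∧ ∃ b c k S j, k ≠ j ∧ val false j S j ∈ A ∧ val false k S j ∈ B ∧
        p = val b j S j ∧ q = val c j S j ∧
        (∀ d, val d j S j ∈ N₁.preset t₁ ↔ d = b) ∧ (∀ d, val d j S j ∈ N₁.postset t₁ ↔ d = c) ∧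
        val b k S j ∈ N₂.preset t₂ ∧ val c k S j ∈ N₂.postset t₂ := by
  constructor
  · rintro ⟨ht, y, hp, hq, hp', hq'⟩
    have h₁ : p ∈ varComp y ∩ N₁.preset t₁ := by rw [hp]; rfl
    have h₂ : q ∈ varComp y ∩ N₁.postset t₁ := by rw [hq]; rfl
    obtain ⟨b, rfl⟩ := mem_varComp.1 h₁.1
    obtain ⟨c, rfl⟩ := mem_varComp.1 h₂.1
    rw [varMap_val] at hp' hq'
    refine ⟨ht, b, c, _, _, _, y.2.1, y.2.2.1, y.2.2.2, rfl, rfl, fun d => ?_, fun d => ?_, hp', hq'⟩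
    · have := Set.ext_iff.1 hp (val d y.1.2.2 y.1.2.1 y.1.2.2)
      simpa [mem_varComp] using this
    · have := Set.ext_iff.1 hq (val d y.1.2.2 y.1.2.1 y.1.2.2)
      simpa [mem_varComp] using this
  · rintro ⟨ht, b, c, k, S, j, hne, hA, hB, rfl, rfl, h₁, h₂, hp, hq⟩
    refine ⟨ht, ⟨(k, S, j), hne, hA, hB⟩, ?_, ?_, ?_, ?_⟩
    · ext x
      simp only [Set.mem_inter_iff, mem_varComp, Set.mem_singleton_iff]
      constructor
      · rintro ⟨⟨d, rfl⟩, hx⟩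
        rw [(h₁ d).1 hx]
      · rintro rfl
        exact ⟨⟨b, rfl⟩, (h₁ b).2 rfl⟩
    · ext x
      simp only [Set.mem_inter_iff, mem_varComp, Set.mem_singleton_iff]
      constructor
      · rintro ⟨⟨d, rfl⟩, hx⟩
        rw [(h₂ d).1 hx]
      · rintro rfl
        exact ⟨⟨c, rfl⟩, (h₂ c).2 rfl⟩
    · rwa [varMap_val]
    · rwa [varMap_val]

end SharedVar

/-! ### Induction step: adding one agent to the composition -/

section Step

variable {N : (i : Fin n) → Net (P i) (T i) Λ} {loops : Prop} {l : List (Fin n)} {k : Fin n}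

theorem HasVar.internal {S : Vec T} {j : Fin n} (h : HasVar N k S j) : HasVar N j S j := by
  rw [hasVar_iff] at *
  exact ⟨h.1, h.2.2, h.2.2⟩

theorem Describes.val_mem (D : Describes N loops l) {b : Bool} {i : Fin n} {S : Vec T}
    {j : Fin n} : (val b i S j : DPlace P T) ∈ (dataComp N loops l).places ↔
      i ∈ l ∧ HasVar N i S j ∧ (i = j ∨ j ∉ l) := by
  rw [D.places, isPlace_val]

theorem internal_left (D : Describes N loops l) (hk : k ∉ l) {p : DPlace P T} :
    p ∈ ⋃ y : SharedVar (dataComp N loops l).places (modNet N loops k).places, varComp y ↔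
      ∃ b S j, p = val b j S j ∧ j ∈ l ∧ HasVar N k S j := by
  rw [mem_iUnion_varComp]
  simp only [D.val_mem, val_mem_modNet]
  constructor
  · rintro ⟨b, i, S, j, rfl, -, ⟨hj, -⟩, rfl, h⟩
    exact ⟨b, S, j, rfl, hj, h⟩
  · rintro ⟨b, S, j, rfl, hj, h⟩
    exact ⟨b, k, S, j, rfl, fun h => hk (h ▸ hj), ⟨hj, h.internal, by simp⟩, rfl, h⟩

theorem external_right (D : Describes N loops l) (hk : k ∉ l) {p : DPlace P T} :
    p ∈ ⋃ y : SharedVar (dataComp N loops l).places (modNet N loops k).places,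
        varMap y '' varComp y ↔
      ∃ b S j, p = val b k S j ∧ j ∈ l ∧ HasVar N k S j := by
  rw [mem_iUnion_varMap]
  simp only [D.val_mem, val_mem_modNet]
  constructor
  · rintro ⟨b, i, S, j, rfl, -, ⟨hj, -⟩, rfl, h⟩
    exact ⟨b, S, j, rfl, hj, h⟩
  · rintro ⟨b, S, j, rfl, hj, h⟩
    exact ⟨b, k, S, j, rfl, fun h => hk (h ▸ hj), ⟨hj, h.internal, by simp⟩, rfl, h⟩

theorem internal_right (D : Describes N loops l) (hk : k ∉ l) {p : DPlace P T} :
    p ∈ ⋃ y : SharedVar (modNet N loops k).places (dataComp N loops l).places, varComp y ↔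
      ∃ b S i, p = val b k S k ∧ i ∈ l ∧ HasVar N i S k := by
  rw [mem_iUnion_varComp]
  simp only [D.val_mem, val_mem_modNet]
  constructor
  · rintro ⟨b, i, S, j, rfl, -, ⟨rfl, -⟩, hi, h, -⟩
    exact ⟨b, S, i, rfl, hi, h⟩
  · rintro ⟨b, S, i, rfl, hi, h⟩
    exact ⟨b, i, S, k, rfl, fun h => hk (h ▸ hi), ⟨rfl, h.internal⟩, hi, h, .inr hk⟩

theorem external_left (D : Describes N loops l) (hk : k ∉ l) {p : DPlace P T} :
    p ∈ ⋃ y : SharedVar (modNet N loops k).places (dataComp N loops l).places,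
        varMap y '' varComp y ↔
      ∃ b S i, p = val b i S k ∧ i ∈ l ∧ HasVar N i S k := by
  rw [mem_iUnion_varMap]
  simp only [D.val_mem, val_mem_modNet]
  constructor
  · rintro ⟨b, i, S, j, rfl, -, ⟨rfl, -⟩, hi, h, -⟩
    exact ⟨b, S, i, rfl, hi, h⟩
  · rintro ⟨b, S, i, rfl, hi, h⟩
    exact ⟨b, i, S, k, rfl, fun h => hk (h ▸ hi), ⟨rfl, h.internal⟩, hi, h, .inr hk⟩

/-- The set differences in the definition remove nothing: a disappearing place is a copy whose
holder and owner differ, one of them being `k` and the other in `l`, whereas the places that stay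
belong to internal variables. -/
theorem mem_fusedAway (D : Describes N loops l) (hk : k ∉ l) {p : DPlace P T} :
    p ∈ Net.fusedAway
        (varComp (A := (dataComp N loops l).places) (B := (modNet N loops k).places)) varMap
        (varComp (A := (modNet N loops k).places) (B := (dataComp N loops l).places)) varMap ↔
      ∃ b S i j, p = val b i S j ∧ HasVar N i S j ∧ ((i = k ∧ j ∈ l) ∨ (i ∈ l ∧ j = k)) := by
  simp only [Net.fusedAway, Set.mem_union, Set.mem_sdiff, internal_left D hk, internal_right D hk,
    external_left D hk, external_right D hk]
  constructor
  · rintro (⟨⟨b, S, j, rfl, hj, h⟩, -⟩ | ⟨⟨b, S, i, rfl, hi, h⟩, -⟩)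
    · exact ⟨b, S, k, j, rfl, h, .inl ⟨rfl, hj⟩⟩
    · exact ⟨b, S, i, k, rfl, h, .inr ⟨hi, rfl⟩⟩
  · rintro ⟨b, S, i, j, rfl, h, ⟨rfl, hj⟩ | ⟨hi, rfl⟩⟩
    · refine .inl ⟨⟨b, S, j, rfl, hj, h⟩, ?_⟩
      rintro ⟨c, S', i', h', -⟩
      rw [val_inj] at h'
      exact hk (h'.2.2.2 ▸ hj)
    · refine .inr ⟨⟨b, S, i, rfl, hi, h⟩, ?_⟩
      rintro ⟨c, S', i', h', hi', -⟩
      rw [val_inj] at h'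
      exact hk (h'.2.2.2 ▸ hi')

theorem mem_places_cons (D : Describes N loops l) (hk : k ∉ l) (p : DPlace P T) :
    p ∈ (dataComp N loops (k :: l)).places ↔ IsPlace N (k :: l) p := by
  change p ∈ ((dataComp N loops l).places ∪ (modNet N loops k).places) \ Net.fusedAway _ _ _ _ ↔ _
  rw [Set.mem_sdiff, Set.mem_union, mem_fusedAway D hk]
  induction p using place_cases with
  | base i p =>
    rw [D.places]
    simp only [IsPlace, base_mem_modNet, base_ne_val, List.mem_cons]
    grind
  | sync i =>
    rw [D.places]
    simp only [IsPlace, sync_mem_modNet, sync_ne_val, List.mem_cons]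
    grind
  | var b i S j =>
    rw [D.val_mem, val_mem_modNet, isPlace_val]
    simp only [val_inj, List.mem_cons]
    grind

/-- The naming relation is a function on the places present. A disappearing copy has its internal
original as its only new name; every other place keeps its name, and `rename` agrees. -/
theorem fusedName_iff (D : Describes N loops l) (hk : k ∉ l) {p q : DPlace P T}
    (hp : p ∈ (dataComp N loops l).places ∪ (modNet N loops k).places) :
    Net.FusedName
        (varComp (A := (dataComp N loops l).places) (B := (modNet N loops k).places)) varMap
        (varComp (A := (modNet N loops k).places) (B := (dataComp N loops l).places)) varMap p q ↔
      q = rename (k :: l) p := by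
  simp only [Net.FusedName, mem_fusedAway D hk, exists_varMap_eq]
  induction p using place_cases with
  | base i p => simp
  | sync i => simp
  | var b i S j =>
    rw [Set.mem_union, D.val_mem, val_mem_modNet] at hp
    simp only [val_inj, D.val_mem, val_mem_modNet, rename_val, List.mem_cons]
    have hint : HasVar N i S j → HasVar N j S j := HasVar.internal
    by_cases hF : HasVar N i S j ∧ ((i = k ∧ j ∈ l) ∨ (i ∈ l ∧ j = k))
    · have hF' : ∃ b' S' i' j', (b = b' ∧ i = i' ∧ S = S' ∧ j = j') ∧ HasVar N i' S' j' ∧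
          (i' = k ∧ j' ∈ l ∨ i' ∈ l ∧ j' = k) := ⟨b, S, i, j, ⟨rfl, rfl, rfl, rfl⟩, hF⟩
      simp only [hF', not_true_eq_false, false_and, true_and, false_or]
      constructor
      · rintro (⟨c, i', S', j', rfl, ⟨rfl, rfl, rfl, rfl⟩, h⟩ |
          ⟨c, i', S', j', rfl, ⟨rfl, rfl, rfl, rfl⟩, h⟩)
        · rw [if_pos (.inr h.2.1.1)]
        · rw [if_pos (.inl h.2.1.1)]
      · intro h
        rcases hF.2 with ⟨rfl, hj⟩ | ⟨hi, rfl⟩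
        · rw [if_pos (.inr hj)] at h
          exact .inl ⟨b, i, S, j, h, ⟨rfl, rfl, rfl, rfl⟩, fun h => hk (h ▸ hj),
            ⟨hj, hint hF.1, by simp⟩, rfl, hF.1⟩
        · rw [if_pos (.inl rfl)] at h
          exact .inr ⟨b, i, S, j, h, ⟨rfl, rfl, rfl, rfl⟩, fun h => hk (h ▸ hi),
            ⟨rfl, hint hF.1⟩, hi, hF.1, .inr hk⟩
    · have hF' : ¬ ∃ b' S' i' j', (b = b' ∧ i = i' ∧ S = S' ∧ j = j') ∧ HasVar N i' S' j' ∧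
          (i' = k ∧ j' ∈ l ∨ i' ∈ l ∧ j' = k) := by
        rintro ⟨b', S', i', j', ⟨rfl, rfl, rfl, rfl⟩, h⟩
        exact hF h
      simp only [hF', not_false_eq_true, false_and, true_and, or_false]
      -- If the owner is present but the place does not disappear, the variable is internal already,
      -- and renaming has no effect.
      have : (if j = k ∨ j ∈ l then (val b j S j : DPlace P T) else val b i S j) = val b i S j := by
        split_ifs with h
        · have : j = i := by grind
          rw [this]
        · rfl
      rw [this]

theorem rename_mem_places_cons (D : Describes N loops l) (hk : k ∉ l) {p : DPlace P T}
    (hp : p ∈ (dataComp N loops l).places ∪ (modNet N loops k).places) :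
    rename (k :: l) p ∈ (dataComp N loops (k :: l)).places := by
  rw [mem_places_cons D hk]
  induction p using place_cases with
  | base i p =>
    rw [Set.mem_union, D.places] at hp
    simp only [IsPlace, base_mem_modNet, List.mem_cons, rename_base] at *
    grind
  | sync i =>
    rw [Set.mem_union, D.places] at hp
    simp only [IsPlace, sync_mem_modNet, List.mem_cons, rename_sync] at *
    grind
  | var b i S j =>
    rw [Set.mem_union, D.val_mem, val_mem_modNet] at hp
    have hint : HasVar N i S j → HasVar N j S j := HasVar.internal
    rw [rename_val]
    split_ifs with h <;> rw [isPlace_val]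
    · exact ⟨h, by grind, .inl rfl⟩
    · simp only [List.mem_cons] at *
      grind

/-- Common form of the three computations of presets, postsets and activators of the fusion. -/
theorem setOf_fusedName (D : Describes N loops l) (hk : k ∉ l) {Q : DPlace P T → Prop}
    (hQ : ∀ p, Q p → p ∈ (dataComp N loops l).places ∪ (modNet N loops k).places) :
    {q | q ∈ (dataComp N loops (k :: l)).places ∧ ∃ p, Net.FusedName
        (varComp (A := (dataComp N loops l).places) (B := (modNet N loops k).places)) varMap
        (varComp (A := (modNet N loops k).places) (B := (dataComp N loops l).places)) varMap p q ∧
        Q p} = rename (k :: l) '' {p | Q p} := by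
  ext q
  simp only [Set.mem_ofPred_eq, Set.mem_image]
  constructor
  · rintro ⟨-, p, hpq, hp⟩
    exact ⟨p, hp, ((fusedName_iff D hk (hQ p hp)).1 hpq).symm⟩
  · rintro ⟨p, hp, rfl⟩
    exact ⟨rename_mem_places_cons D hk (hQ p hp), p, (fusedName_iff D hk (hQ p hp)).2 rfl, hp⟩

theorem preset_cons (D : Describes N loops l) (hk : k ∉ l)
    (U : Set (FTrans T l) × Set (DTrans T)) :
    (dataComp N loops (k :: l)).preset U = rename (k :: l) ''
      ((⋃ t ∈ U.1, (dataComp N loops l).preset t) ∪ ⋃ t ∈ U.2, (modNet N loops k).preset t) := by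
  refine (setOf_fusedName D hk (Q := fun p => (∃ t ∈ U.1, p ∈ (dataComp N loops l).preset t) ∨
    ∃ t ∈ U.2, p ∈ (modNet N loops k).preset t) ?_).trans ?_
  · rintro p (⟨t, -, h⟩ | ⟨t, -, h⟩)
    exacts [.inl h.1, .inr h.1]
  · congr 1
    ext p
    simp

theorem postset_cons (D : Describes N loops l) (hk : k ∉ l)
    (U : Set (FTrans T l) × Set (DTrans T)) :
    (dataComp N loops (k :: l)).postset U = rename (k :: l) ''
      ((⋃ t ∈ U.1, (dataComp N loops l).postset t) ∪ ⋃ t ∈ U.2, (modNet N loops k).postset t) := by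
  refine (setOf_fusedName D hk (Q := fun p => (∃ t ∈ U.1, p ∈ (dataComp N loops l).postset t) ∨
    ∃ t ∈ U.2, p ∈ (modNet N loops k).postset t) ?_).trans ?_
  · rintro p (⟨t, -, h⟩ | ⟨t, -, h⟩)
    exacts [.inl h.1, .inr h.1]
  · congr 1
    ext p
    simp

theorem activators_cons (D : Describes N loops l) (hk : k ∉ l)
    (U : Set (FTrans T l) × Set (DTrans T)) :
    (dataComp N loops (k :: l)).activators U = rename (k :: l) ''
      ((⋃ t ∈ U.1, (dataComp N loops l).activators t) ∪
        ⋃ t ∈ U.2, (modNet N loops k).activators t) := by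
  refine (setOf_fusedName D hk (Q := fun p => (∃ t ∈ U.1, p ∈ (dataComp N loops l).activators t) ∨
    ∃ t ∈ U.2, p ∈ (modNet N loops k).activators t) ?_).trans ?_
  · rintro p (⟨t, -, h⟩ | ⟨t, -, h⟩)
    exacts [.inl h.1, .inr h.1]
  · congr 1
    ext p
    simp

/-- A representative moves either an internal variable or a copy whose owner is still absent, so the
places it consumes from already have their current names. Read arcs enjoy no such property, and
`Represents` has to rename them. -/
theorem rename_preset {r : DTrans T} (hr : IsRepr N l r) :
    rename l '' (modNet N loops (owner r)).preset r = (modNet N loops (owner r)).preset r := by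
  refine (Set.image_congr fun p hp => ?_).trans (Set.image_id _)
  induction p using place_cases with
  | base i p => rfl
  | sync i => rfl
  | var b i S j =>
    obtain ⟨rfl, -, h⟩ := val_mem_preset.1 hp
    rw [h, isRepr_mv] at hr
    rw [rename_val]
    split_ifs with hj
    · rw [hr.2.2.resolve_right (not_not.2 hj)]; rfl
    · rfl

theorem rename_postset {r : DTrans T} (hr : IsRepr N l r) :
    rename l '' (modNet N loops (owner r)).postset r = (modNet N loops (owner r)).postset r := by
  refine (Set.image_congr fun p hp => ?_).trans (Set.image_id _)
  induction p using place_cases with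
  | base i p => rfl
  | sync i => rfl
  | var b i S j =>
    obtain ⟨c, rfl⟩ : ∃ c, b = !c := ⟨!b, by simp⟩
    obtain ⟨rfl, -, h⟩ := val_mem_postset.1 hp
    rw [h, isRepr_mv] at hr
    rw [rename_val]
    split_ifs with hj
    · rw [hr.2.2.resolve_right (not_not.2 hj)]; rfl
    · rfl

theorem rename_cons_rename (p : DPlace P T) :
    rename (k :: l) (rename l p) = rename (k :: l) p := by
  induction p using place_cases with
  | base i p => rfl
  | sync i => rfl
  | var b i S j =>
    by_cases hj : j ∈ l <;> simp [rename_val, hj]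

theorem Represents.left (D : Describes N loops l) (hk : k ∉ l) {t : FTrans T l} {r : DTrans T}
    (ht : Represents N loops l t r) (hr : IsRepr N (k :: l) r) :
    Represents N loops (k :: l) (({t}, ∅) : Set (FTrans T l) × Set (DTrans T)) r where
  preset := by
    rw [preset_cons D hk]
    simpa [ht.preset] using rename_preset hr
  postset := by
    rw [postset_cons D hk]
    simpa [ht.postset] using rename_postset hr
  activators := by
    rw [activators_cons D hk]
    simp [ht.activators, Set.image_image, rename_cons_rename]

theorem represents_right (D : Describes N loops l) (hk : k ∉ l) {r : DTrans T}
    (hr : IsRepr N (k :: l) r) (ho : owner r = k) :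
    Represents N loops (k :: l) ((∅, {r}) : Set (FTrans T l) × Set (DTrans T)) r where
  preset := by
    rw [preset_cons D hk]
    simpa [ho] using rename_preset (loops := loops) hr
  postset := by
    rw [postset_cons D hk]
    simpa [ho] using rename_postset (loops := loops) hr
  activators := by
    rw [activators_cons D hk]
    simp [ho]

/-- The partner moves only the new agent's copy, which gets the name of the internal variable
already moved by `t`. -/
theorem Represents.fuse_left (D : Describes N loops l) (hk : k ∉ l) {t : FTrans T l} {b : Bool}
    {S : Vec T} {j : Fin n} (ht : Represents N loops l t (mv b j S j)) (hj : j ∈ l)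
    (h : HasVar N k S j) :
    Represents N loops (k :: l) (({t}, {mv b k S j}) : Set (FTrans T l) × Set (DTrans T))
      (mv b j S j) := by
  have hr : IsRepr N (k :: l) (mv b j S j) :=
    isRepr_mv.2 ⟨List.mem_cons_of_mem _ hj, h.internal, .inl rfl⟩
  have hjk : j ≠ k := fun h => hk (h ▸ hj)
  have hren : ∀ c, rename (k :: l) (val c k S j : DPlace P T) = val c j S j := fun c => by
    simp [rename_val, hj]
  constructor
  · rw [preset_cons D hk]
    simp only [Set.mem_singleton_iff, Set.iUnion_iUnion_eq_left, ht.preset, Set.image_union,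
      rename_preset hr, preset_external hjk h, Set.image_singleton, hren]
    refine Set.union_eq_self_of_subset_right (Set.singleton_subset_iff.2 ?_)
    exact val_mem_preset.2 ⟨by simp, by simpa using h.internal, by simp⟩
  · rw [postset_cons D hk]
    simp only [Set.mem_singleton_iff, Set.iUnion_iUnion_eq_left, ht.postset, Set.image_union,
      rename_postset hr, postset_external hjk h, Set.image_singleton, hren]
    refine Set.union_eq_self_of_subset_right (Set.singleton_subset_iff.2 ?_)
    exact val_mem_postset.2 ⟨by simp, by simpa using h.internal, by simp⟩
  · rw [activators_cons D hk]
    simp [ht.activators, activators_external hjk, Set.image_image, rename_cons_rename]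

/-- When the owner `k` arrives, the copies held by several earlier agents may merge into its
variable at once, so the internal move is fused with a whole set `C` of external ones. All their
places collapse onto those of the internal variable. -/
theorem represents_fuse_right (D : Describes N loops l) (hk : k ∉ l) {C : Set (FTrans T l)}
    {b : Bool} {S : Vec T} (h : HasVar N k S k)
    (hC : ∀ t ∈ C, ∃ i ∈ l, HasVar N i S k ∧ Represents N loops l t (mv b i S k)) :
    Represents N loops (k :: l) ((C, {mv b k S k}) : Set (FTrans T l) × Set (DTrans T))
      (mv b k S k) := by
  have hr : IsRepr N (k :: l) (mv b k S k) := isRepr_mv.2 ⟨by simp, h, .inl rfl⟩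
  have hren : ∀ c i, rename (k :: l) (val c i S k : DPlace P T) = val c k S k := fun c i => by
    simp [rename_val]
  have hne : ∀ i ∈ l, k ≠ i := fun i hi h => hk (h ▸ hi)
  have e₁ := rename_preset (loops := loops) hr
  have e₂ := rename_postset (loops := loops) hr
  rw [owner_mv] at e₁ e₂
  constructor
  · rw [preset_cons D hk, Set.image_union]
    simp only [Set.mem_singleton_iff, Set.iUnion_iUnion_eq_left, owner_mv, e₁]
    refine Set.union_eq_self_of_subset_left ?_
    rintro _ ⟨p, hp, rfl⟩
    simp only [Set.mem_iUnion] at hp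
    obtain ⟨t, ht, hp⟩ := hp
    obtain ⟨i, hi, h', ht⟩ := hC t ht
    rw [ht.preset, owner_mv, preset_external (hne i hi) h', Set.mem_singleton_iff] at hp
    rw [hp, hren]
    exact val_mem_preset.2 ⟨rfl, h, rfl⟩
  · rw [postset_cons D hk, Set.image_union]
    simp only [Set.mem_singleton_iff, Set.iUnion_iUnion_eq_left, owner_mv, e₂]
    refine Set.union_eq_self_of_subset_left ?_
    rintro _ ⟨p, hp, rfl⟩
    simp only [Set.mem_iUnion] at hp
    obtain ⟨t, ht, hp⟩ := hp
    obtain ⟨i, hi, h', ht⟩ := hC t ht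
    rw [ht.postset, owner_mv, postset_external (hne i hi) h', Set.mem_singleton_iff] at hp
    rw [hp, hren]
    exact val_mem_postset.2 ⟨rfl, h, rfl⟩
  · rw [activators_cons D hk, Set.image_union]
    simp only [Set.mem_singleton_iff, Set.iUnion_iUnion_eq_left, owner_mv]
    refine Set.union_eq_self_of_subset_left ?_
    rintro _ ⟨p, hp, rfl⟩
    simp only [Set.mem_iUnion] at hp
    obtain ⟨t, ht, hp⟩ := hp
    obtain ⟨i, hi, h', ht⟩ := hC t ht
    rw [ht.activators, owner_mv, activators_external (hne i hi), Set.image_empty] at hp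
    exact hp.elim

/-- The preset and postset of `t` on the component force its representative to be an internal move,
and the copy held by `k` has only one matching move. -/
theorem partners_left (D : Describes N loops l) (hk : k ∉ l) {t : FTrans T l} {r : DTrans T}
    (ht : Represents N loops l t r) {p q : DPlace P T} {s : DTrans T} :
    s ∈ Net.partners (dataComp N loops l) (modNet N loops k)
        (varComp (A := (dataComp N loops l).places) (B := (modNet N loops k).places)) varMap
        t p q ↔
      ∃ b S j, j ∈ l ∧ HasVar N k S j ∧ r = mv b j S j ∧ p = val b j S j ∧ q = val (!b) j S j ∧
        s = mv b k S j := by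
  rw [mem_partners]
  constructor
  · rintro ⟨-, b, c, i, S, j, hne, hA, hB, rfl, rfl, h₁, h₂, h₃, h₄⟩
    obtain ⟨rfl, hv⟩ := val_mem_modNet.1 hB
    have h₁ := (h₁ b).2 rfl
    rw [ht.preset, val_mem_preset] at h₁
    have hj := (D.val_mem.1 hA).1
    obtain ⟨c, rfl⟩ : ∃ d, c = !d := ⟨!c, by simp⟩
    have h₂ := (h₂ _).2 rfl
    rw [ht.postset, val_mem_postset] at h₂
    have hr : r = mv b j S j := h₁.2.2.trans (by rw [← h₁.1])
    have hr' : r = mv c j S j := h₂.2.2.trans (by rw [← h₁.1])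
    obtain rfl : b = c := (mv_inj.1 (hr.symm.trans hr')).1
    exact ⟨b, S, j, hj, hv, hr, rfl, rfl, (val_mem_preset.1 h₃).2.2⟩
  · rintro ⟨b, S, j, hj, h, rfl, rfl, rfl, rfl⟩
    refine ⟨mv_mem_modNet.2 ⟨rfl, h⟩, b, !b, k, S, j, fun h => hk (h ▸ hj),
      D.val_mem.2 ⟨hj, h.internal, .inl rfl⟩, val_mem_modNet.2 ⟨rfl, h⟩, rfl, rfl, fun d => ?_,
      fun d => ?_, val_mem_preset.2 ⟨rfl, h, rfl⟩, val_mem_postset.2 ⟨rfl, h, rfl⟩⟩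
    · rw [ht.preset, val_mem_preset]
      simp [h.internal, eq_comm]
    · obtain ⟨d, rfl⟩ : ∃ e, d = !e := ⟨!d, by simp⟩
      rw [ht.postset, val_mem_postset]
      simp [h.internal, eq_comm]

theorem partners_right (D : Describes N loops l) (hk : k ∉ l) {s : DTrans T}
    {p q : DPlace P T} {t : FTrans T l} :
    t ∈ Net.partners (modNet N loops k) (dataComp N loops l)
        (varComp (A := (modNet N loops k).places) (B := (dataComp N loops l).places)) varMap
        s p q ↔
      t ∈ (dataComp N loops l).trans ∧ ∃ b S i, i ∈ l ∧ HasVar N i S k ∧ s = mv b k S k ∧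
        p = val b k S k ∧ q = val (!b) k S k ∧ Represents N loops l t (mv b i S k) := by
  rw [mem_partners]
  constructor
  · rintro ⟨ht, b, c, i, S, j, hne, hA, hB, rfl, rfl, h₁, h₂, h₃, h₄⟩
    obtain ⟨rfl, hv⟩ := val_mem_modNet.1 hA
    obtain ⟨hi, hv', -⟩ := D.val_mem.1 hB
    obtain ⟨-, -, hs⟩ := val_mem_preset.1 ((h₁ b).2 rfl)
    obtain ⟨c, rfl⟩ : ∃ d, c = !d := ⟨!c, by simp⟩
    obtain ⟨-, -, hs'⟩ := val_mem_postset.1 ((h₂ _).2 rfl)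
    obtain rfl : b = c := (mv_inj.1 (hs.symm.trans hs')).1
    obtain ⟨r, hr, htr⟩ := D.classify t ht
    rw [htr.preset, val_mem_preset] at h₃
    have : r = mv b i S j := h₃.2.2.trans (by rw [← h₃.1])
    exact ⟨ht, b, S, i, hi, hv', hs, rfl, rfl, this ▸ htr⟩
  · rintro ⟨ht, b, S, i, hi, h, rfl, rfl, rfl, hr⟩
    refine ⟨ht, b, !b, i, S, k, fun h => hk (h ▸ hi), val_mem_modNet.2 ⟨rfl, h.internal⟩,
      D.val_mem.2 ⟨hi, h, .inr hk⟩, rfl, rfl, fun d => ?_, fun d => ?_, ?_, ?_⟩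
    · rw [val_mem_preset]
      simp [h.internal, eq_comm]
    · obtain ⟨d, rfl⟩ : ∃ e, d = !e := ⟨!d, by simp⟩
      rw [val_mem_postset]
      simp [h.internal, eq_comm]
    · rw [hr.preset, val_mem_preset]
      simp [h]
    · rw [hr.postset, val_mem_postset]
      simp [h]

/-- A move of a fused variable meets the component on both sides, so it does not qualify for staying
unfused. -/
theorem preset_inter_nonempty_and {Q : Set (DPlace P T)} {i : Fin n} {b : Bool} {S : Vec T}
    {j : Fin n} (h : HasVar N i S j) (hQ : ∀ c, val c i S j ∈ Q) :
    ¬ ((modNet N loops i).preset (mv b i S j) ∩ Q = ∅ ∨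
      (modNet N loops i).postset (mv b i S j) ∩ Q = ∅) := by
  rintro (h' | h')
  · exact Set.eq_empty_iff_forall_notMem.1 h' _ ⟨val_mem_preset.2 ⟨rfl, h, rfl⟩, hQ b⟩
  · exact Set.eq_empty_iff_forall_notMem.1 h' _ ⟨val_mem_postset.2 ⟨rfl, h, rfl⟩, hQ (!b)⟩

theorem mem_left_components (D : Describes N loops l) (hk : k ∉ l) {p : DPlace P T} :
    p ∈ (⋃ y : SharedVar (dataComp N loops l).places (modNet N loops k).places, varComp y) ∪
        (⋃ y : SharedVar (modNet N loops k).places (dataComp N loops l).places,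
          varMap y '' varComp y) ↔
      ∃ b S i j, p = val b i S j ∧ i ∈ l ∧ ((i = j ∧ HasVar N k S j) ∨ (j = k ∧ HasVar N i S k)) := by
  rw [Set.mem_union, internal_left D hk, external_left D hk]
  constructor
  · rintro (⟨b, S, j, rfl, hj, h⟩ | ⟨b, S, i, rfl, hi, h⟩)
    · exact ⟨b, S, j, j, rfl, hj, .inl ⟨rfl, h⟩⟩
    · exact ⟨b, S, i, k, rfl, hi, .inr ⟨rfl, h⟩⟩
  · rintro ⟨b, S, i, j, rfl, hi, ⟨rfl, h⟩ | ⟨rfl, h⟩⟩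
    · exact .inl ⟨b, S, i, rfl, hi, h⟩
    · exact .inr ⟨b, S, i, rfl, hi, h⟩

theorem mem_right_components (D : Describes N loops l) (hk : k ∉ l) {p : DPlace P T} :
    p ∈ (⋃ y : SharedVar (dataComp N loops l).places (modNet N loops k).places,
          varMap y '' varComp y) ∪
        (⋃ y : SharedVar (modNet N loops k).places (dataComp N loops l).places, varComp y) ↔
      ∃ b S j, p = val b k S j ∧ ((j ∈ l ∧ HasVar N k S j) ∨
        (j = k ∧ ∃ i ∈ l, HasVar N i S k)) := by
  rw [Set.mem_union, internal_right D hk, external_right D hk]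
  constructor
  · rintro (⟨b, S, j, rfl, hj, h⟩ | ⟨b, S, i, rfl, hi, h⟩)
    · exact ⟨b, S, j, rfl, .inl ⟨hj, h⟩⟩
    · exact ⟨b, S, k, rfl, .inr ⟨rfl, i, hi, h⟩⟩
  · rintro ⟨b, S, j, rfl, ⟨hj, h⟩ | ⟨rfl, i, hi, h⟩⟩
    · exact .inl ⟨b, S, j, rfl, hj, h⟩
    · exact .inr ⟨b, S, i, rfl, hi, h⟩

theorem partners_left_eq (D : Describes N loops l) (hk : k ∉ l) {t : FTrans T l} {b : Bool}
    {S : Vec T} {j : Fin n} (ht : Represents N loops l t (mv b j S j)) (hj : j ∈ l)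
    (h : HasVar N k S j) :
    Net.partners (dataComp N loops l) (modNet N loops k)
        (varComp (A := (dataComp N loops l).places) (B := (modNet N loops k).places)) varMap
        t (val b j S j) (val (!b) j S j) = {mv b k S j} := by
  ext s
  rw [partners_left D hk ht, Set.mem_singleton_iff]
  constructor
  · rintro ⟨b', S', j', -, -, e, -, -, rfl⟩
    obtain ⟨rfl, -, rfl, rfl⟩ := mv_inj.1 e
    rfl
  · rintro rfl
    exact ⟨b, S, j, hj, h, rfl, rfl, rfl, rfl⟩

/-- The four kinds of transitions of a fusion are treated separately. Fused ones are represented by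
the internal move. An unfused one keeps its representative, which remains admissible because an
external copy with its owner present on the other side would have been fused. -/
theorem classify_cons (D : Describes N loops l) (hk : k ∉ l)
    (U : Set (FTrans T l) × Set (DTrans T)) (hU : U ∈ (dataComp N loops (k :: l)).trans) :
    ∃ r, IsRepr N (k :: l) r ∧ Represents N loops (k :: l) U r := by
  rcases hU with ((⟨t, ht, p, q, hne, rfl⟩ | ⟨s, hs, p, q, hne, rfl⟩) | ⟨t, ht, rfl, hd⟩) |
    ⟨s, hs, rfl, hd⟩
  · obtain ⟨r, hr, htr⟩ := D.classify t ht
    obtain ⟨s, hs⟩ := hne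
    obtain ⟨b, S, j, hj, h, rfl, rfl, rfl, rfl⟩ := (partners_left D hk htr).1 hs
    refine ⟨mv b j S j, isRepr_mv.2 ⟨by simp [hj], h.internal, .inl rfl⟩, ?_⟩
    rw [partners_left_eq D hk htr hj h]
    exact htr.fuse_left D hk hj h
  · obtain ⟨t, ht⟩ := hne
    obtain ⟨-, b, S, i, hi, h, rfl, rfl, rfl, -⟩ := (partners_right D hk).1 ht
    refine ⟨mv b k S k, isRepr_mv.2 ⟨by simp, h.internal, .inl rfl⟩,
      represents_fuse_right D hk h.internal fun t ht => ?_⟩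
    obtain ⟨-, b', S', i', hi', h', e, -, -, ht'⟩ := (partners_right D hk).1 ht
    obtain ⟨rfl, -, rfl, -⟩ := mv_inj.1 e
    exact ⟨i', hi', h', ht'⟩
  · obtain ⟨r, hr, htr⟩ := D.classify t ht
    suffices hr' : IsRepr N (k :: l) r from ⟨r, hr', htr.left D hk hr'⟩
    rw [htr.preset, htr.postset] at hd
    induction r using trans_cases with
    | unique i t => exact ⟨List.mem_cons_of_mem _ hr.1, hr.2⟩
    | move b i S j =>
      rw [isRepr_mv] at hr ⊢
      refine ⟨List.mem_cons_of_mem _ hr.1, hr.2.1, hr.2.2.imp_right fun hj => ?_⟩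
      rw [List.mem_cons]
      rintro (rfl | hj')
      · rw [owner_mv] at hd
        exact preset_inter_nonempty_and hr.2.1 (fun c => (mem_left_components D hk).2
          ⟨c, S, i, j, rfl, hr.1, .inr ⟨rfl, hr.2.1⟩⟩) hd
      · exact hj hj'
  · suffices h : IsRepr N (k :: l) s ∧ owner s = k from ⟨s, h.1, represents_right D hk h.1 h.2⟩
    induction s using trans_cases with
    | unique i t =>
      obtain ⟨rfl, h⟩ := unique_mem_modNet.1 hs
      exact ⟨⟨by simp, h⟩, rfl⟩
    | move b i S j =>
      obtain ⟨rfl, h⟩ := mv_mem_modNet.1 hs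
      refine ⟨isRepr_mv.2 ⟨by simp, h, ?_⟩, by simp⟩
      by_contra! hj
      have hj' : j ∈ l := by simpa [hj.1.symm] using hj.2
      exact preset_inter_nonempty_and h (fun c => (mem_right_components D hk).2
          ⟨c, S, j, rfl, .inl ⟨hj', h⟩⟩) hd

theorem left_mem_trans_cons (D : Describes N loops l) (hk : k ∉ l) {t : FTrans T l}
    (ht : t ∈ (dataComp N loops l).trans) {r : DTrans T} (hr : Represents N loops l t r)
    (hd : ∀ b S i j, r = mv b i S j → i ∈ l →
      ¬ ((i = j ∧ HasVar N k S j) ∨ (j = k ∧ HasVar N i S k))) :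
    (({t}, ∅) : Set (FTrans T l) × Set (DTrans T)) ∈ (dataComp N loops (k :: l)).trans := by
  refine .inl (.inr ⟨t, ht, rfl, .inl ?_⟩)
  rw [hr.preset, Set.eq_empty_iff_forall_notMem]
  rintro p ⟨hp, hc⟩
  obtain ⟨b, S, i, j, rfl, hi, h⟩ := (mem_left_components D hk).1 hc
  obtain ⟨hi', -, hr'⟩ := val_mem_preset.1 hp
  exact hd b S i j (hr'.trans (by rw [hi'])) hi h

theorem right_mem_trans_cons (D : Describes N loops l) (hk : k ∉ l) {s : DTrans T}
    (hs : s ∈ (modNet N loops k).trans)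
    (hd : ∀ b S j, s = mv b k S j →
      ¬ ((j ∈ l ∧ HasVar N k S j) ∨ (j = k ∧ ∃ i ∈ l, HasVar N i S k))) :
    ((∅, {s}) : Set (FTrans T l) × Set (DTrans T)) ∈ (dataComp N loops (k :: l)).trans := by
  refine .inr ⟨s, hs, rfl, .inl ?_⟩
  rw [Set.eq_empty_iff_forall_notMem]
  rintro p ⟨hp, hc⟩
  obtain ⟨b, S, j, rfl, h⟩ := (mem_right_components D hk).1 hc
  exact hd b S j (val_mem_preset.1 hp).2.2 h

/-- Each representative has to occur in some form, fused or not: it is fused exactly when its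
variable is shared between `k` and the agents of `l`, and otherwise it survives alone. -/
theorem realize_cons (D : Describes N loops l) (hk : k ∉ l) (r : DTrans T)
    (hr : IsRepr N (k :: l) r) :
    ∃ U ∈ (dataComp N loops (k :: l)).trans, Represents N loops (k :: l) U r := by
  induction r using trans_cases with
  | unique i t =>
    by_cases hi : i = k
    · refine ⟨_, right_mem_trans_cons D hk (unique_mem_modNet.2 ⟨hi, hr.2⟩) ?_,
        represents_right D hk hr hi⟩
      intro b S j h
      simp at h
    · obtain ⟨t', ht', hr'⟩ := D.realize (.unique i t) ⟨(List.mem_cons.1 hr.1).resolve_left hi, hr.2⟩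
      refine ⟨_, left_mem_trans_cons D hk ht' hr' ?_, hr'.left D hk hr⟩
      intro b S i j h
      simp at h
  | move b i S j =>
    obtain ⟨hi, h, hij⟩ := isRepr_mv.1 hr
    by_cases hik : i = k
    · subst hik
      by_cases hji : j = i
      · subst hji
        -- There are no partners if no agent of `l` holds a copy of this variable; the internal move
        -- then stays unfused.
        by_cases hp : (Net.partners (modNet N loops j) (dataComp N loops l)
          (varComp (A := (modNet N loops j).places) (B := (dataComp N loops l).places)) varMap
          (mv b j S j) (val b j S j) (val (!b) j S j)).Nonempty
        · refine ⟨_, .inl (.inl (.inr ⟨mv b j S j, mv_mem_modNet.2 ⟨rfl, h⟩, _, _, hp, rfl⟩)),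
            represents_fuse_right D hk h fun t ht => ?_⟩
          obtain ⟨-, b', S', i', hi', h', e, -, -, ht'⟩ := (partners_right D hk).1 ht
          obtain ⟨rfl, -, rfl, -⟩ := mv_inj.1 e
          exact ⟨i', hi', h', ht'⟩
        · refine ⟨_, right_mem_trans_cons D hk (mv_mem_modNet.2 ⟨rfl, h⟩) ?_,
            represents_right D hk hr (owner_mv ..)⟩
          intro b' S' j' e
          obtain ⟨rfl, -, rfl, rfl⟩ := mv_inj.1 e
          rintro (⟨h', -⟩ | ⟨-, i, hi, h'⟩)
          · exact hk h'
          · obtain ⟨t, ht, hr'⟩ := D.realize (mv b i S j) (isRepr_mv.2 ⟨hi, h', .inr hk⟩)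
            exact hp ⟨t, (partners_right D hk).2
              ⟨ht, b, S, i, hi, h', rfl, rfl, rfl, hr'⟩⟩
      · refine ⟨_, right_mem_trans_cons D hk (mv_mem_modNet.2 ⟨rfl, h⟩) ?_,
            represents_right D hk hr (owner_mv ..)⟩
        intro b' S' j' e
        obtain ⟨rfl, -, rfl, rfl⟩ := mv_inj.1 e
        have := hij.resolve_left (Ne.symm hji)
        simp only [List.mem_cons, not_or] at this
        rintro (⟨h', -⟩ | ⟨h', -⟩)
        exacts [this.2 h', this.1 h']
    · have hil := (List.mem_cons.1 hi).resolve_left hik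
      obtain ⟨t, ht, hr'⟩ := D.realize (mv b i S j) (isRepr_mv.2 ⟨hil, h,
        hij.imp_right fun h h' => h (List.mem_cons_of_mem _ h')⟩)
      by_cases hc : i = j ∧ HasVar N k S j
      · obtain ⟨rfl, hv⟩ := hc
        have e := partners_left_eq D hk hr' hil hv
        refine ⟨_, .inl (.inl (.inl ⟨t, ht, val b i S i, val (!b) i S i, ?_, rfl⟩)), ?_⟩
        · exact e ▸ Set.singleton_nonempty _
        · rw [e]
          exact hr'.fuse_left D hk hil hv
      · refine ⟨_, left_mem_trans_cons D hk ht hr' ?_, hr'.left D hk hr⟩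
        intro b' S' i' j' e _
        obtain ⟨rfl, rfl, rfl, rfl⟩ := mv_inj.1 e
        rintro (h' | ⟨rfl, -⟩)
        · exact hc h'
        · exact hij.elim hik fun h => h (by simp)

theorem describes_dataComp (N : (i : Fin n) → Net (P i) (T i) Λ) (loops : Prop)
    (l : List (Fin n)) (hl : l.Nodup) : Describes N loops l := by
  induction l with
  | nil =>
    refine ⟨fun p => ?_, fun p hp => hp.elim, fun t ht => ht.elim, fun r hr => ?_⟩
    · cases p <;> simp [IsPlace, dataComp, Net.empty]
    · cases r <;> simp [IsRepr] at hr
  | cons k l ih =>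
    obtain ⟨hk, hl⟩ := List.nodup_cons.1 hl
    have D := ih hl
    refine ⟨mem_places_cons D hk, fun p hp => ?_, classify_cons D hk, realize_cons D hk⟩
    by_cases h : p ∈ (dataComp N loops l).places
    · exact (if_pos h).trans (D.init p h)
    · exact if_neg h

end Step

end MAS

/-! ### Token equations and transitions of the action based composition -/

namespace Net

variable {P : Type u} {T : Type v} {Λ : Type w}

-- Enabledness prevents the truncated subtraction in the firing rule from truncating, so the three
-- cases merge into one additive equation. A place in both preset and postset contributes the same
-- summand on both sides.
open Classical in
theorem fires_iff (N : Net P T Λ) (m : N.Marking) (t : T) (m' : N.Marking) :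
    N.Fires m t m' ↔ t ∈ N.trans ∧
      (∀ p : N.places, (p : P) ∈ N.preset t ∨ (p : P) ∈ N.activators t → 0 < m p) ∧
      ∀ p : N.places, m' p + (if (p : P) ∈ N.preset t then 1 else 0) =
        m p + if (p : P) ∈ N.postset t then 1 else 0 := by
  have h₁ : ∀ p : N.places, (p : P) ∈ N.preset t ↔ N.pre p t := fun p => and_iff_right p.2
  have h₂ : ∀ p : N.places, (p : P) ∈ N.postset t ↔ N.post p t := fun p => and_iff_right p.2
  have h₃ : ∀ p : N.places, (p : P) ∈ N.activators t ↔ N.read p t := fun p => and_iff_right p.2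
  simp only [Fires, Enabled, h₁, h₂, h₃, and_assoc]
  refine and_congr_right fun _ => and_congr_right fun h => forall_congr' fun p => ?_
  have hp : N.pre p t → 0 < m p := fun h' => h p (.inl h')
  by_cases hpre : N.pre p t <;> by_cases hpost : N.post p t <;> simp [hpre, hpost] at hp ⊢
  omega

end Net

namespace MAS

variable {n : ℕ} {P : Fin n → Type u} {T : Fin n → Type v} {Λ : Type w}

/-- The vector in which only agent `i` takes part. -/
def single (i : Fin n) (t : T i) : Vec T := Function.update (fun _ => none) i (some t)

@[simp] theorem single_self (i : Fin n) (t : T i) : single i t i = some t :=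
  Function.update_self ..

theorem single_of_ne {i j : Fin n} (h : j ≠ i) (t : T i) : single i t j = none :=
  Function.update_of_ne h ..

theorem single_mem_trans {N : (i : Fin n) → Net (P i) (T i) Λ} {i : Fin n} {t : T i}
    (ht : t ∈ (N i).trans) (hs : (N i).label t ∉ sharedEvents N i) :
    single i t ∈ (actComp N).trans := by
  have hm : (N i).label t ∈ (N i).alphabet := ⟨t, ht, rfl⟩
  refine ⟨(N i).label t, ⟨i, hm⟩, fun j => ?_⟩
  by_cases h : j = i
  · subst h
    exact ⟨fun _ => ⟨t, ht, rfl, single_self j t⟩, fun h => (h hm).elim⟩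
  · exact ⟨fun hj => (hs ⟨hm, j, h, hj⟩).elim, fun _ => single_of_ne h t⟩

theorem mem_trans_cases {N : (i : Fin n) → Net (P i) (T i) Λ} {S : Vec T}
    (hS : S ∈ (actComp N).trans) :
    IsShared N S ∨ ∃ i t, t ∈ (N i).trans ∧ (N i).label t ∉ sharedEvents N i ∧ S = single i t := by
  obtain ⟨a, ⟨i, hi⟩, hS⟩ := hS
  by_cases h : ∃ j, j ≠ i ∧ a ∈ (N j).alphabet
  · obtain ⟨j, hne, hj⟩ := h
    exact .inl ⟨a, hS, j, i, hne, hj, hi⟩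
  · obtain ⟨t, ht, rfl, hSi⟩ := (hS i).1 hi
    refine .inr ⟨i, t, ht, fun hs => h hs.2, ?_⟩
    funext j
    by_cases hj : j = i
    · subst hj
      simpa using hSi
    · rw [single_of_ne hj]
      exact (hS j).2 fun h' => h ⟨j, hj, h'⟩

theorem IsShared.mem_trans {N : (i : Fin n) → Net (P i) (T i) Λ} {S : Vec T}
    (hS : IsShared N S) : S ∈ (actComp N).trans := by
  obtain ⟨a, hS, i, -, -, hi, -⟩ := hS
  exact ⟨a, ⟨i, hi⟩, hS⟩

theorem IsShared.hasVar {N : (i : Fin n) → Net (P i) (T i) Λ} {S : Vec T} (hS : IsShared N S)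
    {i : Fin n} (hi : S i ≠ none) : HasVar N i S i :=
  hasVar_iff.2 ⟨hS, hi, hi⟩

/-- The part of agent `i` in `S` consumes from `p`. -/
def Consumes (N : (i : Fin n) → Net (P i) (T i) Λ) (S : Vec T) (i : Fin n) (p : P i) : Prop :=
  ∃ t, S i = some t ∧ (N i).pre p t

/-- The part of agent `i` in `S` produces on `p`. -/
def Produces (N : (i : Fin n) → Net (P i) (T i) Λ) (S : Vec T) (i : Fin n) (p : P i) : Prop :=
  ∃ t, S i = some t ∧ (N i).post p t

theorem not_consumes {N : (i : Fin n) → Net (P i) (T i) Λ} {S : Vec T} {i : Fin n} {p : P i}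
    (h : S i = none) : ¬ Consumes N S i p := by
  rintro ⟨t, ht, -⟩
  simp [h] at ht

theorem not_produces {N : (i : Fin n) → Net (P i) (T i) Λ} {S : Vec T} {i : Fin n} {p : P i}
    (h : S i = none) : ¬ Produces N S i p := by
  rintro ⟨t, ht, -⟩
  simp [h] at ht

-- Agents have no read arcs, so enabledness in the composition depends on consumption only.
open Classical in
theorem actComp_fires_iff {N : (i : Fin n) → Net (P i) (T i) Λ} (hN : ∀ i, (N i).IsAgent)
    (M : (actComp N).Marking) (S : Vec T) (M' : (actComp N).Marking) :
    (actComp N).Fires M S M' ↔ S ∈ (actComp N).trans ∧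
      (∀ i p (h : p ∈ (N i).places), Consumes N S i p → 0 < M ⟨⟨i, p⟩, h⟩) ∧
      ∀ i p (h : p ∈ (N i).places),
        M' ⟨⟨i, p⟩, h⟩ + (if Consumes N S i p then 1 else 0) =
          M ⟨⟨i, p⟩, h⟩ + if Produces N S i p then 1 else 0 := by
  rw [Net.fires_iff]
  have h₁ : ∀ i p, p ∈ (N i).places →
      ((⟨i, p⟩ : Σ i, P i) ∈ (actComp N).preset S ↔ Consumes N S i p) :=
    fun i p h => and_iff_right h
  have h₂ : ∀ i p, p ∈ (N i).places →
      ((⟨i, p⟩ : Σ i, P i) ∈ (actComp N).postset S ↔ Produces N S i p) :=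
    fun i p h => and_iff_right h
  refine and_congr_right fun hS => and_congr ⟨fun H i p h hc => ?_, ?_⟩ ⟨fun H i p h => ?_, ?_⟩
  · exact H ⟨⟨i, p⟩, h⟩ (.inl ((h₁ i p h).2 hc))
  · rintro H ⟨⟨i, p⟩, h⟩ (h' | ⟨-, t, ht, hr⟩)
    · exact H i p h ((h₁ i p h).1 h')
    · obtain ⟨a, -, hS⟩ := hS
      by_cases ha : a ∈ (N i).alphabet
      · obtain ⟨t', ht', -, e⟩ := (hS i).1 ha
        obtain rfl : t = t' := Option.some.inj (ht.symm.trans e)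
        exact ((hN i).no_read p h t ht' hr).elim
      · have := (hS i).2 ha
        simp only [] at ht
        rw [this] at ht
        simp at ht
  · have := H ⟨⟨i, p⟩, h⟩
    simpa only [h₁ i p h, h₂ i p h] using this
  · rintro H ⟨⟨i, p⟩, h⟩
    simpa only [h₁ i p h, h₂ i p h] using H i p h

/-! ### Arcs of unsplit transitions and of internal moves -/

section Local

variable {N : (i : Fin n) → Net (P i) (T i) Λ} {loops : Prop}

theorem base_mem_preset_unique {i j : Fin n} {p : P i} {t : T j} :
    DPlace.base i p ∈ (modNet N loops j).preset (.unique j t) ↔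
      p ∈ (N i).places ∧ Consumes N (single j t) i p := by
  constructor
  · rintro ⟨h, h'⟩
    cases h'
    exact ⟨h.2, t, single_self i t, ‹_›⟩
  · rintro ⟨h, t', ht', hp⟩
    by_cases hij : i = j
    · subst hij
      rw [single_self, Option.some.injEq] at ht'
      subst ht'
      exact ⟨⟨rfl, h⟩, .unique p t hp⟩
    · rw [single_of_ne hij] at ht'
      simp at ht'

theorem base_mem_postset_unique {i j : Fin n} {p : P i} {t : T j} :
    DPlace.base i p ∈ (modNet N loops j).postset (.unique j t) ↔
      p ∈ (N i).places ∧ Produces N (single j t) i p := by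
  constructor
  · rintro ⟨h, h'⟩
    cases h'
    exact ⟨h.2, t, single_self i t, ‹_›⟩
  · rintro ⟨h, t', ht', hp⟩
    by_cases hij : i = j
    · subst hij
      rw [single_self, Option.some.injEq] at ht'
      subst ht'
      exact ⟨⟨rfl, h⟩, .unique p t hp⟩
    · rw [single_of_ne hij] at ht'
      simp at ht'

theorem sync_mem_preset_unique {i j : Fin n} {t : T j} :
    (DPlace.sync i : DPlace P T) ∈ (modNet N loops j).preset (.unique j t) ↔ i = j ∧ loops := by
  constructor
  · rintro ⟨-, h'⟩
    cases h'
    exact ⟨rfl, ‹_›⟩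
  · rintro ⟨rfl, h⟩
    exact ⟨rfl, .uniqueSync t h⟩

theorem sync_mem_postset_unique {i j : Fin n} {t : T j} :
    (DPlace.sync i : DPlace P T) ∈ (modNet N loops j).postset (.unique j t) ↔ i = j ∧ loops := by
  constructor
  · rintro ⟨-, h'⟩
    cases h'
    exact ⟨rfl, ‹_›⟩
  · rintro ⟨rfl, h⟩
    exact ⟨rfl, .uniqueSync t h⟩

theorem base_mem_preset_mv {b : Bool} {i j : Fin n} {p : P i} {S : Vec T} :
    DPlace.base i p ∈ (modNet N loops j).preset (mv b j S j) ↔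
      b = false ∧ i = j ∧ p ∈ (N i).places ∧ Consumes N S i p := by
  constructor
  · rintro ⟨h, h'⟩
    cases b <;> cases h'
    exact ⟨rfl, rfl, h.2, _, ‹_›, ‹_›⟩
  · rintro ⟨rfl, rfl, h, t, ht, hp⟩
    exact ⟨⟨rfl, h⟩, .begBase p S t ht hp⟩

theorem base_mem_postset_mv {b : Bool} {i j : Fin n} {p : P i} {S : Vec T} :
    DPlace.base i p ∈ (modNet N loops j).postset (mv b j S j) ↔
      b = true ∧ i = j ∧ p ∈ (N i).places ∧ Produces N S i p := by
  constructor
  · rintro ⟨h, h'⟩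
    cases b <;> cases h'
    exact ⟨rfl, rfl, h.2, _, ‹_›, ‹_›⟩
  · rintro ⟨rfl, rfl, h, t, ht, hp⟩
    exact ⟨⟨rfl, h⟩, .finBase p S t ht hp⟩

theorem sync_mem_preset_mv {b : Bool} {i j : Fin n} {S : Vec T} :
    (DPlace.sync i : DPlace P T) ∈ (modNet N loops j).preset (mv b j S j) ↔
      b = false ∧ i = j := by
  constructor
  · rintro ⟨-, h'⟩
    cases b <;> cases h'
    exact ⟨rfl, rfl⟩
  · rintro ⟨rfl, rfl⟩
    exact ⟨rfl, .begSync S⟩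

theorem sync_mem_postset_mv {b : Bool} {i j : Fin n} {S : Vec T} :
    (DPlace.sync i : DPlace P T) ∈ (modNet N loops j).postset (mv b j S j) ↔
      b = true ∧ i = j := by
  constructor
  · rintro ⟨-, h'⟩
    cases b <;> cases h'
    exact ⟨rfl, rfl⟩
  · rintro ⟨rfl, rfl⟩
    exact ⟨rfl, .finSync S⟩

theorem activators_unique {j : Fin n} {t : T j} :
    (modNet N loops j).activators (.unique j t) = ∅ := by
  ext p
  simp only [Set.mem_empty_iff_false, iff_false]
  rintro ⟨-, h⟩
  cases h

-- The four kinds of read arcs fit one formula: the first agent reads at its predecessor the value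
-- that it is itself about to leave, any other agent the value that it is about to take.
open Classical in
theorem mem_activators_mv {b : Bool} {j : Fin n} {S : Vec T} (h : HasVar N j S j)
    {p : DPlace P T} : p ∈ (modNet N loops j).activators (mv b j S j) ↔
      ∃ i, IsPrev S j i ∧ p = val (if IsFirst S j then b else !b) j S i := by
  constructor
  · rintro ⟨-, h⟩
    cases b <;> cases h <;> rename_i i hf hp <;> exact ⟨i, hp, by simp [hf, val]⟩
  · rintro ⟨i, hp, rfl⟩
    refine ⟨val_mem_modNet.2 ⟨rfl, h.1, hp.1⟩, ?_⟩
    by_cases hf : IsFirst S j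
    · rw [if_pos hf]
      cases b
      exacts [.begFirst S i hf hp, .finFirst S i hf hp]
    · rw [if_neg hf]
      cases b
      exacts [.begOther S i hf hp, .finOther S i hf hp]

end Local

/-! ### Firing expressed through representatives -/

section Complete

variable {N : (i : Fin n) → Net (P i) (T i) Λ} {loops : Prop} {l : List (Fin n)}

open Classical in
/-- The effect of the transition `r` in a composition of all agents. -/
structure Moves (N : (i : Fin n) → Net (P i) (T i) Λ) (loops : Prop) (l : List (Fin n))
    (m : (dataComp N loops l).Marking) (r : DTrans T) (m' : (dataComp N loops l).Marking) :
    Prop where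
  preset : ∀ p : (dataComp N loops l).places,
    (p : DPlace P T) ∈ (modNet N loops (owner r)).preset r → 0 < m p
  activators : ∀ p : (dataComp N loops l).places,
    (p : DPlace P T) ∈ rename l '' (modNet N loops (owner r)).activators r → 0 < m p
  tokens : ∀ p : (dataComp N loops l).places,
    m' p + (if (p : DPlace P T) ∈ (modNet N loops (owner r)).preset r then 1 else 0) =
      m p + if (p : DPlace P T) ∈ (modNet N loops (owner r)).postset r then 1 else 0

/-- Distinct transitions of the fusion may share a representative, but reachability needs only the
existence of a firing transition, so no bijection is required. -/
theorem exists_fires_iff (hl : l.Nodup) {m m' : (dataComp N loops l).Marking} :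
    (∃ t, (dataComp N loops l).Fires m t m') ↔ ∃ r, IsRepr N l r ∧ Moves N loops l m r m' := by
  have D := describes_dataComp N loops l hl
  constructor
  · rintro ⟨t, ht⟩
    rw [Net.fires_iff] at ht
    obtain ⟨ht, h₁, h₂⟩ := ht
    obtain ⟨r, hr, htr⟩ := D.classify t ht
    rw [htr.preset, htr.activators] at h₁
    rw [htr.preset, htr.postset] at h₂
    exact ⟨r, hr, fun p hp => h₁ p (.inl hp), fun p hp => h₁ p (.inr hp), h₂⟩
  · rintro ⟨r, hr, h⟩
    obtain ⟨t, ht, htr⟩ := D.realize r hr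
    refine ⟨t, ?_⟩
    rw [Net.fires_iff, htr.preset, htr.activators, htr.postset]
    exact ⟨ht, fun p hp => hp.elim (h.preset p) (h.activators p), h.tokens⟩

end Complete

/-! ### The cyclic order of the agents of a synchronization -/

section Cyclic

variable {S : Vec T} {i j : Fin n}

theorem exists_isPrev (hj : S j ≠ none) : ∃ i, IsPrev S j i := by
  classical
  by_cases h : ∃ i, i < j ∧ S i ≠ none
  · obtain ⟨i, hi⟩ := h
    obtain ⟨k, hk, hmax⟩ := (Finset.univ.filter fun i => i < j ∧ S i ≠ none).exists_max_image id
      ⟨i, by simpa using hi⟩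
    simp only [Finset.mem_filter, Finset.mem_univ, true_and, id] at hk hmax
    exact ⟨k, hk.2, .inl ⟨hk.1, fun k' h₁ h₂ => hmax k' ⟨h₁, h₂⟩⟩⟩
  · obtain ⟨k, hk, hmax⟩ := (Finset.univ.filter fun i => S i ≠ none).exists_max_image id
      ⟨j, by simpa using hj⟩
    simp only [Finset.mem_filter, Finset.mem_univ, true_and, id] at hk hmax
    push Not at h
    exact ⟨k, hk, .inr ⟨h, hmax⟩⟩

theorem IsPrev.le_of_isFirst (h : IsPrev S j i) (hf : IsFirst S j) {k : Fin n}
    (hk : S k ≠ none) : k ≤ i := by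
  rcases h.2 with h' | h'
  · exact absurd (hf.2 i h.1) (not_le.2 h'.1)
  · exact h'.2 k hk

theorem IsPrev.lt_of_not_isFirst (h : IsPrev S j i) (hj : S j ≠ none) (hf : ¬ IsFirst S j) :
    i < j ∧ ∀ k, k < j → S k ≠ none → k ≤ i := by
  rcases h.2 with h' | h'
  · exact h'
  · exact (hf ⟨hj, fun k hk => not_lt.1 fun hkj => hk (h'.1 k hkj)⟩).elim

end Cyclic

/-! ### Firing in the composition of all agents -/

section Complete

variable {N : (i : Fin n) → Net (P i) (T i) Λ} {loops : Prop} {l : List (Fin n)}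

theorem base_mem_dataComp (hl : l.Nodup) (hall : ∀ i, i ∈ l) {i : Fin n} {p : P i} :
    DPlace.base i p ∈ (dataComp N loops l).places ↔ p ∈ (N i).places := by
  rw [(describes_dataComp N loops l hl).places]
  exact and_iff_right (hall i)

theorem sync_mem_dataComp (hl : l.Nodup) (hall : ∀ i, i ∈ l) (i : Fin n) :
    (DPlace.sync i : DPlace P T) ∈ (dataComp N loops l).places := by
  rw [(describes_dataComp N loops l hl).places]
  exact hall i

theorem val_mem_dataComp (hl : l.Nodup) (hall : ∀ i, i ∈ l) {b : Bool} {i : Fin n} {S : Vec T}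
    {j : Fin n} : (val b i S j : DPlace P T) ∈ (dataComp N loops l).places ↔
      i = j ∧ HasVar N i S i := by
  rw [(describes_dataComp N loops l hl).val_mem]
  constructor
  · rintro ⟨-, h, rfl | h'⟩
    exacts [⟨rfl, h⟩, (h' (hall j)).elim]
  · rintro ⟨rfl, h⟩
    exact ⟨hall i, h, .inl rfl⟩

open Classical in
/-- The effect of a change of the variable of agent `j` for the synchronization `S`. -/
structure VarMoves (N : (i : Fin n) → Net (P i) (T i) Λ) (loops : Prop) (l : List (Fin n))
    (m : (dataComp N loops l).Marking) (b : Bool) (S : Vec T) (j : Fin n)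
    (m' : (dataComp N loops l).Marking) : Prop where
  pos_base : b = false → ∀ p h, Consumes N S j p → 0 < m ⟨.base j p, h⟩
  pos_sync : b = false → ∀ h, 0 < m ⟨.sync j, h⟩
  pos_val : ∀ h, 0 < m ⟨val b j S j, h⟩
  pos_prev : ∀ i, IsPrev S j i → ∀ h, 0 < m ⟨val (if IsFirst S j then b else !b) i S i, h⟩
  tokens_base : ∀ i p h,
    m' ⟨.base i p, h⟩ + (if b = false ∧ i = j ∧ Consumes N S i p then 1 else 0) =
      m ⟨.base i p, h⟩ + if b = true ∧ i = j ∧ Produces N S i p then 1 else 0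
  tokens_sync : ∀ i h, m' ⟨.sync i, h⟩ + (if b = false ∧ i = j then 1 else 0) =
    m ⟨.sync i, h⟩ + if b = true ∧ i = j then 1 else 0
  tokens_val : ∀ c i S' h, m' ⟨val c i S' i, h⟩ + (if i = j ∧ S' = S ∧ c = b then 1 else 0) =
    m ⟨val c i S' i, h⟩ + if i = j ∧ S' = S ∧ c = !b then 1 else 0

open Classical in
/-- The effect of an unsplit transition. -/
structure UniqueMoves (N : (i : Fin n) → Net (P i) (T i) Λ) (loops : Prop) (l : List (Fin n))
    (m : (dataComp N loops l).Marking) (j : Fin n) (t : T j)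
    (m' : (dataComp N loops l).Marking) : Prop where
  pos_base : ∀ i p h, Consumes N (single j t) i p → 0 < m ⟨.base i p, h⟩
  pos_sync : loops → ∀ h, 0 < m ⟨.sync j, h⟩
  tokens_base : ∀ i p h,
    m' ⟨.base i p, h⟩ + (if Consumes N (single j t) i p then 1 else 0) =
      m ⟨.base i p, h⟩ + if Produces N (single j t) i p then 1 else 0
  tokens_sync : ∀ i h, m' ⟨.sync i, h⟩ = m ⟨.sync i, h⟩
  tokens_val : ∀ c i S' h, m' ⟨val c i S' i, h⟩ = m ⟨val c i S' i, h⟩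

theorem moves_mv_iff (hl : l.Nodup) (hall : ∀ i, i ∈ l) {m m' : (dataComp N loops l).Marking}
    {b : Bool} {S : Vec T} {j : Fin n} (hv : HasVar N j S j) :
    Moves N loops l m (mv b j S j) m' ↔ VarMoves N loops l m b S j m' := by
  classical
  have key : ∀ c i S', (val c i S' i : DPlace P T) ∈ (modNet N loops j).preset (mv b j S j) ↔
      i = j ∧ S' = S ∧ c = b := fun c i S' => by
    rw [val_mem_preset, mv_inj]
    grind
  have key' : ∀ c i S', (val c i S' i : DPlace P T) ∈ (modNet N loops j).postset (mv b j S j) ↔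
      i = j ∧ S' = S ∧ c = !b := fun c i S' => by
    obtain ⟨c, rfl⟩ : ∃ d, c = !d := ⟨!c, by simp⟩
    rw [val_mem_postset, mv_inj, Bool.not_inj_iff]
    grind
  constructor
  · rintro ⟨h₁, h₂, h₃⟩
    rw [owner_mv] at h₁ h₂ h₃
    refine ⟨fun hb p h hc => h₁ _ (base_mem_preset_mv.2
        ⟨hb, rfl, (base_mem_dataComp hl hall).1 h, hc⟩),
      fun hb h => h₁ _ (sync_mem_preset_mv.2 ⟨hb, rfl⟩),
      fun h => h₁ _ ((key _ _ _).2 ⟨rfl, rfl, rfl⟩), fun i hi h => h₂ _ ?_, fun i p h => ?_,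
      fun i h => ?_, fun c i S' h => ?_⟩
    -- All agents are present, so the copy that is read carries the name of the predecessor's
    -- internal variable.
    · exact ⟨_, (mem_activators_mv hv).2 ⟨i, hi, rfl⟩, by simp [rename_val, hall]⟩
    · have hp := (base_mem_dataComp hl hall).1 h
      simpa only [base_mem_preset_mv, base_mem_postset_mv, hp, true_and] using h₃ ⟨_, h⟩
    · simpa only [sync_mem_preset_mv, sync_mem_postset_mv] using h₃ ⟨_, h⟩
    · simpa only [key, key'] using h₃ ⟨_, h⟩
  · intro H
    refine ⟨?_, ?_, ?_⟩ <;> rw [owner_mv]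
    · rintro ⟨p, h⟩ hp
      induction p using place_cases with
      | base i p =>
        obtain ⟨hb, rfl, -, hc⟩ := base_mem_preset_mv.1 hp
        exact H.pos_base hb p h hc
      | sync i =>
        obtain ⟨hb, rfl⟩ := sync_mem_preset_mv.1 hp
        exact H.pos_sync hb h
      | var c i S' j' =>
        obtain ⟨rfl, -⟩ := (val_mem_dataComp hl hall).1 h
        obtain ⟨rfl, rfl, rfl⟩ := (key _ _ _).1 hp
        exact H.pos_val h
    · rintro ⟨p, h⟩ ⟨q, hq, e⟩
      obtain ⟨i, hi, rfl⟩ := (mem_activators_mv hv).1 hq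
      simp only [rename_val, hall, if_true] at e
      subst e
      exact H.pos_prev i hi h
    · rintro ⟨p, h⟩
      induction p using place_cases with
      | base i p =>
        have hp := (base_mem_dataComp hl hall).1 h
        simpa only [base_mem_preset_mv, base_mem_postset_mv, hp, true_and] using
          H.tokens_base i p h
      | sync i => simpa only [sync_mem_preset_mv, sync_mem_postset_mv] using H.tokens_sync i h
      | var c i S' j' =>
        obtain ⟨rfl, -⟩ := (val_mem_dataComp hl hall).1 h
        simpa only [key, key'] using H.tokens_val c i S' h

theorem moves_unique_iff (hl : l.Nodup) (hall : ∀ i, i ∈ l)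
    {m m' : (dataComp N loops l).Marking} {j : Fin n} {t : T j} :
    Moves N loops l m (.unique j t) m' ↔ UniqueMoves N loops l m j t m' := by
  classical
  have key : ∀ c i S' i',
      (val c i S' i' : DPlace P T) ∉ (modNet N loops j).preset (.unique j t) := by
    simp [val_mem_preset]
  have key' : ∀ c i S' i',
      (val c i S' i' : DPlace P T) ∉ (modNet N loops j).postset (.unique j t) := by
    intro c i S' i'
    obtain ⟨c, rfl⟩ : ∃ d, c = !d := ⟨!c, by simp⟩
    simp [val_mem_postset]
  constructor
  · rintro ⟨h₁, h₂, h₃⟩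
    rw [owner_unique] at h₁ h₂ h₃
    refine ⟨fun i p h hc => h₁ _ (base_mem_preset_unique.2
        ⟨(base_mem_dataComp hl hall).1 h, hc⟩),
      fun hb h => h₁ _ (sync_mem_preset_unique.2 ⟨rfl, hb⟩), fun i p h => ?_,
      fun i h => ?_, fun c i S' h => ?_⟩
    · have hp := (base_mem_dataComp hl hall).1 h
      simpa only [base_mem_preset_unique, base_mem_postset_unique, hp, true_and] using h₃ ⟨_, h⟩
    · simpa only [sync_mem_preset_unique, sync_mem_postset_unique, add_left_inj] using h₃ ⟨_, h⟩
    · simpa only [key, key', if_false, add_zero] using h₃ ⟨_, h⟩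
  · intro H
    refine ⟨?_, ?_, ?_⟩ <;> rw [owner_unique]
    · rintro ⟨p, h⟩ hp
      induction p using place_cases with
      | base i p => exact H.pos_base i p h (base_mem_preset_unique.1 hp).2
      | sync i =>
        obtain ⟨rfl, hb⟩ := sync_mem_preset_unique.1 hp
        exact H.pos_sync hb h
      | var c i S' j' => exact (key _ _ _ _ hp).elim
    · rintro ⟨p, h⟩ ⟨q, hq, -⟩
      rw [activators_unique] at hq
      exact hq.elim
    · rintro ⟨p, h⟩
      induction p using place_cases with
      | base i p =>
        have hp := (base_mem_dataComp hl hall).1 h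
        simpa only [base_mem_preset_unique, base_mem_postset_unique, hp, true_and] using
          H.tokens_base i p h
      | sync i =>
        simpa only [sync_mem_preset_unique, sync_mem_postset_unique, add_left_inj] using
          H.tokens_sync i h
      | var c i S' j' =>
        obtain ⟨rfl, -⟩ := (val_mem_dataComp hl hall).1 h
        simpa only [key, key', if_false, add_zero] using H.tokens_val c i S' h

/-- Firings in the composition of all agents: either an unsplit transition fires or a part of a
synchronization begins or ends. -/
theorem exists_fires_iff_moves (hl : l.Nodup) (hall : ∀ i, i ∈ l)
    {m m' : (dataComp N loops l).Marking} :
    (∃ t, (dataComp N loops l).Fires m t m') ↔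
      (∃ j, ∃ t ∈ (N j).trans, (N j).label t ∉ sharedEvents N j ∧
        UniqueMoves N loops l m j t m') ∨
      ∃ b S j, HasVar N j S j ∧ VarMoves N loops l m b S j m' := by
  rw [exists_fires_iff hl]
  constructor
  · rintro ⟨r, hr, h⟩
    induction r using trans_cases with
    | unique j t => exact .inl ⟨j, t, hr.2.1, hr.2.2, (moves_unique_iff hl hall).1 h⟩
    | move b i S j =>
      obtain ⟨-, hv, rfl | hj⟩ := isRepr_mv.1 hr
      · exact .inr ⟨b, S, i, hv, (moves_mv_iff hl hall hv).1 h⟩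
      · exact (hj (hall j)).elim
  · rintro (⟨j, t, ht, hs, h⟩ | ⟨b, S, j, hv, h⟩)
    · exact ⟨.unique j t, ⟨hall j, ht, hs⟩, (moves_unique_iff hl hall).2 h⟩
    · exact ⟨_, isRepr_mv.2 ⟨hall j, hv, .inl rfl⟩, (moves_mv_iff hl hall hv).2 h⟩

theorem sp_base (M : (actComp N).Marking) {i : Fin n} {p : P i}
    (h : DPlace.base i p ∈ (dataComp N loops l).places) :
    sp N loops l M ⟨.base i p, h⟩ = M ⟨⟨i, p⟩, base_mem_places N loops l i p h⟩ := rfl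

theorem sp_sync (M : (actComp N).Marking) {i : Fin n}
    (h : DPlace.sync i ∈ (dataComp N loops l).places) :
    sp N loops l M ⟨.sync i, h⟩ = 1 := rfl

theorem sp_val (M : (actComp N).Marking) {b : Bool} {i : Fin n} {S : Vec T} {j : Fin n}
    (h : val b i S j ∈ (dataComp N loops l).places) :
    sp N loops l M ⟨val b i S j, h⟩ = if b = false then 1 else 0 := by
  cases b <;> rfl

theorem sp_m0 (hl : l.Nodup) : sp N loops l (actComp N).m0 = (dataComp N loops l).m0 := by
  have D := describes_dataComp N loops l hl
  funext ⟨p, h⟩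
  refine Eq.trans ?_ (D.init p h).symm
  cases p <;> rfl

end Complete

/-! ### From the data driven to the action based composition -/

section Abstraction

variable {N : (i : Fin n) → Net (P i) (T i) Λ} {loops : Prop} {l : List (Fin n)}

/-- `p` lacks a token because agent `i` is in the middle of its part of a synchronization `S`: one
that will be produced if `S` is committed, one that has been consumed otherwise. -/
def Owes (N : (i : Fin n) → Net (P i) (T i) Λ) (cur : Fin n → Option (Vec T))
    (com : Vec T → Prop) (i : Fin n) (p : P i) : Prop :=
  ∃ S, cur i = some S ∧ ((com S ∧ Produces N S i p) ∨ (¬ com S ∧ Consumes N S i p))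

theorem not_owes {cur : Fin n → Option (Vec T)} {com : Vec T → Prop} {i : Fin n} {p : P i}
    (h : cur i = none) : ¬ Owes N cur com i p := by
  rintro ⟨S, hS, -⟩
  simp [h] at hS

theorem owes_iff {cur : Fin n → Option (Vec T)} {com : Vec T → Prop} {i : Fin n} {p : P i}
    {S : Vec T} (h : cur i = some S) : Owes N cur com i p ↔
      ((com S ∧ Produces N S i p) ∨ (¬ com S ∧ Consumes N S i p)) := by
  simp [Owes, h]

open Classical in
/-- The marking of the action based composition in which the agents have not yet begun the
synchronizations that are not committed, and have finished those that are. -/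
noncomputable def abstraction (hl : l.Nodup) (hall : ∀ i, i ∈ l)
    (m : (dataComp N loops l).Marking) (cur : Fin n → Option (Vec T)) (com : Vec T → Prop) :
    (actComp N).Marking :=
  fun p => m ⟨.base p.1.1 p.1.2, (base_mem_dataComp hl hall).2 p.2⟩ +
    if Owes N cur com p.1.1 p.1.2 then 1 else 0

open Classical in
/-- In the marking `m`, agent `i` is in the middle of its part of `cur i`, and the synchronizations
in `com` are committed. -/
structure Tracks (N : (i : Fin n) → Net (P i) (T i) Λ) (loops : Prop) (l : List (Fin n))
    (m : (dataComp N loops l).Marking) (cur : Fin n → Option (Vec T)) (com : Vec T → Prop) :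
    Prop where
  sync : ∀ i h, m ⟨.sync i, h⟩ = if cur i = none then 1 else 0
  val : ∀ b i S h, m ⟨val b i S i, h⟩ = if (cur i = some S ↔ b = true) then 1 else 0
  hasVar : ∀ i S, cur i = some S → HasVar N i S i
  committed : ∀ S, com S → ∀ i j, i < j → S j ≠ none → cur i = some S → cur j = some S
  uncommitted : ∀ S, ¬ com S → ∀ i j, i < j → S i ≠ none → cur j = some S → cur i = some S

/-- The abstraction only adds tokens to the original places, so enabledness carries over, and the
added tokens are the same before and after. Agent `j` may even be busy. -/
theorem Tracks.unique {hl : l.Nodup} {hall : ∀ i, i ∈ l} (hN : ∀ i, (N i).IsAgent)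
    {m m' : (dataComp N loops l).Marking} {cur : Fin n → Option (Vec T)} {com : Vec T → Prop}
    (H : Tracks N loops l m cur com) {j : Fin n} {t : T j} (ht : t ∈ (N j).trans)
    (hs : (N j).label t ∉ sharedEvents N j) (h : UniqueMoves N loops l m j t m') :
    Tracks N loops l m' cur com ∧
      (actComp N).Fires (abstraction hl hall m cur com) (single j t)
        (abstraction hl hall m' cur com) := by
  refine ⟨⟨fun i hi => ?_, fun b i S hi => ?_, H.hasVar, H.committed, H.uncommitted⟩, ?_⟩
  · rw [h.tokens_sync, H.sync]
  · rw [h.tokens_val, H.val]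
  · rw [actComp_fires_iff hN]
    refine ⟨single_mem_trans ht hs, fun i p hp hc => ?_, fun i p hp => ?_⟩
    · exact Nat.add_pos_left (h.pos_base i p _ hc) _
    · have := h.tokens_base i p ((base_mem_dataComp hl hall).2 hp)
      simp only [abstraction]
      omega

theorem Tracks.begin {hl : l.Nodup} {hall : ∀ i, i ∈ l}
    {m m' : (dataComp N loops l).Marking} {cur : Fin n → Option (Vec T)} {com : Vec T → Prop}
    (H : Tracks N loops l m cur com) {S : Vec T} {j : Fin n} (hv : HasVar N j S j)
    (h : VarMoves N loops l m false S j m') :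
    ∃ cur' com', Tracks N loops l m' cur' com' ∧
      abstraction hl hall m' cur' com' = abstraction hl hall m cur com := by
  classical
  obtain ⟨hS, hj, -⟩ := hasVar_iff.1 hv
  have hcur : cur j = none := by
    have h₁ := h.pos_sync rfl (sync_mem_dataComp hl hall j)
    rw [H.sync] at h₁
    by_contra h₂
    simp [h₂] at h₁
  obtain ⟨i, hi⟩ := exists_isPrev hj
  have hiv : (MAS.val (if IsFirst S j then false else !false) i S i : DPlace P T) ∈
      (dataComp N loops l).places := (val_mem_dataComp hl hall).2 ⟨rfl, hS.hasVar hi.1⟩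
  have hprev := h.pos_prev i hi hiv
  rw [H.val] at hprev
  -- A beginning cannot overlap a committed run of `S`. If `j` is first, the last agent is idle, and
  -- with a final segment of busy agents so is everyone; otherwise the predecessor is busy, and the
  -- final segment would contain `j`, which is idle.
  have hbusy : ∀ k, cur k = some S → ¬ com S := by
    intro k hk hcom
    have hkS := (hasVar_iff.1 (H.hasVar k S hk)).2.1
    by_cases hf : IsFirst S j
    · simp only [hf, if_true, Bool.false_eq_true, iff_false] at hprev
      have hi' : cur i ≠ some S := by
        intro h'
        simp [h'] at hprev
      rcases (hi.le_of_isFirst hf hkS).lt_or_eq with hlt | rfl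
      · exact hi' (H.committed S hcom k i hlt hi.1 hk)
      · exact hi' hk
    · simp only [hf, if_false, Bool.not_false, iff_true] at hprev
      have hi' : cur i = some S := by
        by_contra h'
        simp [h'] at hprev
      have := H.committed S hcom i j (hi.lt_of_not_isFirst hj hf).1 hj hi'
      simp [hcur] at this
  -- Any earlier commitment of `S` is withdrawn here. By `hbusy` nobody is busy with a committed
  -- `S`, so no owed token changes.
  refine ⟨Function.update cur j (some S), fun S' => com S' ∧ S' ≠ S, ⟨fun i hi => ?_,
    fun b i S' hi => ?_, fun i S' => ?_, ?_, ?_⟩, ?_⟩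
  · have := h.tokens_sync i hi
    rw [H.sync] at this
    by_cases hij : i = j
    · subst hij
      simp_all
    · simp_all
  · have := h.tokens_val b i S' hi
    rw [H.val] at this
    by_cases hij : i = j
    · subst hij
      by_cases hSS : S' = S
      · subst hSS
        cases b <;> simp_all
      · simpa [hcur, hSS, Ne.symm hSS] using this
    · simp_all
  · by_cases hij : i = j
    · subst hij
      rw [Function.update_self]
      rintro ⟨⟩
      exact hv
    · rw [Function.update_of_ne hij]
      exact H.hasVar i S'
  · rintro S' ⟨hcom, hne⟩ i k hik hk hi
    have hij : i ≠ j := by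
      rintro rfl
      simp only [Function.update_self, Option.some.injEq] at hi
      exact hne hi.symm
    rw [Function.update_of_ne hij] at hi
    have hk' := H.committed S' hcom i k hik hk hi
    have hkj : k ≠ j := by
      rintro rfl
      simp [hcur] at hk'
    rwa [Function.update_of_ne hkj]
  · intro S' hcom i' k hik hi' hk
    by_cases hSS : S' = S
    · subst hSS
      by_cases hij : i' = j
      · rw [hij, Function.update_self]
      rw [Function.update_of_ne hij]
      by_cases hkj : k = j
      · subst hkj
        by_cases hf : IsFirst S' k
        · exact absurd (hf.2 i' hi') (not_le.2 hik)
        · simp only [hf, if_false, Bool.not_false, iff_true] at hprev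
          have hi'' : cur i = some S' := by
            by_contra h'
            simp [h'] at hprev
          -- The predecessor is busy, so the initial segment reaches up to it and `j` extends the
          -- segment by one.
          rcases ((hi.lt_of_not_isFirst hj hf).2 i' hik hi').lt_or_eq with hlt | rfl
          · exact H.uncommitted S' (hbusy i hi'') i' i hlt hi' hi''
          · exact hi''
      · rw [Function.update_of_ne hkj] at hk
        exact H.uncommitted S' (hbusy k hk) i' k hik hi' hk
    · have hkj : k ≠ j := by
        rintro rfl
        simp only [Function.update_self, Option.some.injEq] at hk
        exact hSS hk.symm
      rw [Function.update_of_ne hkj] at hk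
      have := H.uncommitted S' (fun h => hcom ⟨h, hSS⟩) i' k hik hi' hk
      have hij : i' ≠ j := by
        rintro rfl
        simp [hcur] at this
      rwa [Function.update_of_ne hij]
  · funext ⟨⟨i, p⟩, hp⟩
    have := h.tokens_base i p ((base_mem_dataComp hl hall).2 hp)
    simp only [abstraction]
    by_cases hij : i = j
    · subst hij
      rw [if_neg (not_owes hcur)]
      rw [owes_iff (S := S) (Function.update_self ..)]
      simpa using this
    · have e : Owes N (Function.update cur j (some S)) (fun S' => com S' ∧ S' ≠ S) i p ↔
          Owes N cur com i p := by
        simp only [Owes, Function.update_of_ne hij]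
        refine exists_congr fun S' => and_congr_right fun hS' => ?_
        have : com S' ∧ S' ≠ S ↔ com S' := by
          refine and_iff_left_of_imp fun hcom => ?_
          rintro rfl
          exact hbusy i hS' hcom
        rw [this]
      rw [e]
      simpa [hij] using this

theorem Tracks.finish {hl : l.Nodup} {hall : ∀ i, i ∈ l} (hN : ∀ i, (N i).IsAgent)
    {m m' : (dataComp N loops l).Marking} {cur : Fin n → Option (Vec T)} {com : Vec T → Prop}
    (H : Tracks N loops l m cur com) {S : Vec T} {j : Fin n} (hv : HasVar N j S j)
    (h : VarMoves N loops l m true S j m') :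
    ∃ cur' com', Tracks N loops l m' cur' com' ∧
      (abstraction hl hall m' cur' com' = abstraction hl hall m cur com ∨
        (actComp N).Fires (abstraction hl hall m cur com) S
          (abstraction hl hall m' cur' com')) := by
  classical
  obtain ⟨hS, hj, -⟩ := hasVar_iff.1 hv
  have hcur : cur j = some S := by
    have h₁ := h.pos_val ((val_mem_dataComp hl hall).2 ⟨rfl, hv⟩)
    rw [H.val] at h₁
    by_contra h₂
    simp [h₂] at h₁
  obtain ⟨i, hi⟩ := exists_isPrev hj
  have hiv : (MAS.val (if IsFirst S j then true else !true) i S i : DPlace P T) ∈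
      (dataComp N loops l).places := (val_mem_dataComp hl hall).2 ⟨rfl, hS.hasVar hi.1⟩
  have hprev := h.pos_prev i hi hiv
  rw [H.val] at hprev
  have hfirst : IsFirst S j → cur i = some S := by
    intro hf
    by_contra h'
    simp [hf, h'] at hprev
  have hother : ¬ IsFirst S j → cur i ≠ some S := by
    intro hf h'
    simp [hf, h'] at hprev
  -- Before the commit the busy agents form an initial segment, so the predecessor of a busy agent
  -- that is not first is busy as well; but such an agent may end only when its predecessor is idle.
  have hcomf : ¬ com S → IsFirst S j := by
    intro hcom
    by_contra hf
    exact hother hf (H.uncommitted S hcom i j (hi.lt_of_not_isFirst hj hf).1 hi.1 hcur)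
  -- The first agent ends only if the last one is busy, and an initial segment containing the last
  -- agent is everything.
  have hall' : ¬ com S → ∀ k, S k ≠ none → cur k = some S := by
    intro hcom k hk
    have hf := hcomf hcom
    rcases (hi.le_of_isFirst hf hk).lt_or_eq with hlt | rfl
    · exact H.uncommitted S hcom k i hlt hk (hfirst hf)
    · exact hfirst hf
  refine ⟨Function.update cur j none, fun S' => com S' ∨ S' = S, ⟨fun i hi => ?_,
    fun b i S' hi => ?_, fun i S' => ?_, ?_, ?_⟩, ?_⟩
  · have := h.tokens_sync i hi
    rw [H.sync] at this
    by_cases hij : i = j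
    · subst hij
      simp_all
    · simp_all
  · have := h.tokens_val b i S' hi
    rw [H.val] at this
    by_cases hij : i = j
    · subst hij
      by_cases hSS : S' = S
      · subst hSS
        cases b <;> simp_all
      · simpa [hcur, hSS, Ne.symm hSS] using this
    · simp_all
  · by_cases hij : i = j
    · subst hij
      simp
    · rw [Function.update_of_ne hij]
      exact H.hasVar i S'
  · intro S' hcom i' k hik hk hi'
    have hij : i' ≠ j := by
      rintro rfl
      simp at hi'
    rw [Function.update_of_ne hij] at hi'
    by_cases hSS : S' = S
    · subst hSS
      have hi'S := (hasVar_iff.1 (H.hasVar i' S' hi')).2.1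
      by_cases hcom' : com S'
      -- If a smaller agent were still busy, the final segment would contain the predecessor of `j`,
      -- contrary to the read arc. Hence `j` is the smallest busy agent and its removal leaves a
      -- final segment.
      · have hk' := H.committed S' hcom' i' k hik hk hi'
        have hkj : k ≠ j := by
          rintro rfl
          by_cases hf : IsFirst S' k
          · exact absurd (hf.2 i' hi'S) (not_le.2 hik)
          · rcases ((hi.lt_of_not_isFirst hj hf).2 i' hik hi'S).lt_or_eq with hlt | rfl
            · exact hother hf (H.committed S' hcom' i' i hlt hi.1 hi')
            · exact hother hf hi'
        rwa [Function.update_of_ne hkj]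
      · have hkj : k ≠ j := by
          rintro rfl
          exact absurd ((hcomf hcom').2 i' hi'S) (not_le.2 hik)
        rw [Function.update_of_ne hkj]
        exact hall' hcom' k hk
    · have hk' := H.committed S' (hcom.resolve_right hSS) i' k hik hk hi'
      have hkj : k ≠ j := by
        rintro rfl
        rw [hcur, Option.some.injEq] at hk'
        exact hSS hk'.symm
      rwa [Function.update_of_ne hkj]
  · intro S' hcom i' k hik hi' hk
    push Not at hcom
    have hkj : k ≠ j := by
      rintro rfl
      simp at hk
    rw [Function.update_of_ne hkj] at hk
    have hi'' := H.uncommitted S' hcom.1 i' k hik hi' hk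
    have hij : i' ≠ j := by
      rintro rfl
      rw [hcur, Option.some.injEq] at hi''
      exact hcom.2 hi''.symm
    rwa [Function.update_of_ne hij]
  · have howes : ∀ i p, i ≠ j → cur i ≠ some S →
        (Owes N (Function.update cur j none) (fun S' => com S' ∨ S' = S) i p ↔
          Owes N cur com i p) := by
      intro i p hij hiS
      simp only [Owes, Function.update_of_ne hij]
      refine exists_congr fun S' => and_congr_right fun hS' => ?_
      have : com S' ∨ S' = S ↔ com S' := or_iff_left fun h => hiS (h ▸ hS')
      rw [this]
    have htok := fun i p hp => h.tokens_base i p ((base_mem_dataComp hl hall).2 hp)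
    -- After the commit the token owed by `j` becomes a real one. At the commit, all agents of `S`
    -- switch from owing what they consumed to owing, or in the case of `j` having delivered, what
    -- they produce: this is one firing of `S`.
    by_cases hcom : com S
    · left
      have : (fun S' => com S' ∨ S' = S) = com :=
        funext fun S' => propext (or_iff_left_of_imp fun h => h ▸ hcom)
      rw [this]
      funext ⟨⟨i, p⟩, hp⟩
      have := htok i p hp
      simp only [abstraction]
      by_cases hij : i = j
      · subst hij
        rw [if_neg (not_owes (Function.update_self ..)), owes_iff hcur]
        simpa [hcom] using this
      · have e : Owes N (Function.update cur j none) com i p ↔ Owes N cur com i p := by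
          simp only [Owes, Function.update_of_ne hij]
        rw [e]
        simpa [hij] using this
    · right
      rw [actComp_fires_iff hN]
      refine ⟨hS.mem_trans, fun i p hp hc => ?_, fun i p hp => ?_⟩
      · have hi : cur i = some S := hall' hcom i fun h => not_consumes h hc
        refine Nat.add_pos_right _ ?_
        simp [owes_iff hi, hcom, hc]
      · have := htok i p hp
        simp only [abstraction]
        by_cases hiS : S i = none
        · have hi : cur i ≠ some S := fun h => (hasVar_iff.1 (H.hasVar i S h)).2.1 hiS
          have hij : i ≠ j := by
            rintro rfl
            exact hj hiS
          rw [howes i p hij hi, if_neg (not_consumes hiS), if_neg (not_produces hiS)]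
          simp only [hij, false_and, and_false, if_false, add_zero] at this
          rw [this]
        · have hi := hall' hcom i hiS
          rw [owes_iff hi]
          by_cases hij : i = j
          · subst hij
            rw [if_neg (not_owes (Function.update_self ..))]
            simp only [Bool.true_eq_false, false_and, if_false, true_and, add_zero] at this
            simp only [hcom, false_and, not_false_eq_true, true_and, false_or, this]
            omega
          · rw [owes_iff (S := S) (by rwa [Function.update_of_ne hij])]
            simp only [hij, false_and, and_false, if_false, add_zero] at this
            simp only [hcom, false_and, not_false_eq_true, true_and, false_or, or_true,
              not_true_eq_false, or_false, this]
            omega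

theorem reachable_of_reachable_sp (hN : ∀ i, (N i).IsAgent) (hl : l.Nodup) (hall : ∀ i, i ∈ l)
    {M : (actComp N).Marking} (h : (dataComp N loops l).Reachable (sp N loops l M)) :
    (actComp N).Reachable M := by
  have key : ∀ m, (dataComp N loops l).Reachable m → ∃ cur com, Tracks N loops l m cur com ∧
      (actComp N).Reachable (abstraction hl hall m cur com) := by
    intro m hm
    induction hm with
    | refl =>
      refine ⟨fun _ => none, fun _ => False, ⟨fun i h => ?_, fun b i S h => ?_, ?_, ?_, ?_⟩, ?_⟩
      · rw [← sp_m0 hl, sp_sync, if_pos rfl]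
      · rw [← sp_m0 hl, sp_val]
        simp
      · simp
      · simp
      · simp
      · have : abstraction hl hall (dataComp N loops l).m0 (fun _ => none) (fun _ => False) =
            (actComp N).m0 := by
          funext p
          rw [abstraction, if_neg (not_owes rfl), ← sp_m0 hl]
          rfl
        rw [this]
        exact .refl
    | tail _ hstep ih =>
      obtain ⟨cur, com, H, hR⟩ := ih
      rcases (exists_fires_iff_moves hl hall).1 hstep with ⟨j, t, ht, hs, h⟩ | ⟨b, S, j, hv, h⟩
      · obtain ⟨H', hF⟩ := H.unique (hl := hl) (hall := hall) hN ht hs h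
        exact ⟨cur, com, H', hR.tail ⟨_, hF⟩⟩
      · cases b
        · obtain ⟨cur', com', H', e⟩ := H.begin (hl := hl) (hall := hall) hv h
          exact ⟨cur', com', H', e ▸ hR⟩
        · obtain ⟨cur', com', H', e | hF⟩ := H.finish (hl := hl) (hall := hall) hN hv h
          · exact ⟨cur', com', H', e ▸ hR⟩
          · exact ⟨cur', com', H', hR.tail ⟨_, hF⟩⟩
  obtain ⟨cur, com, H, hR⟩ := key _ h
  -- The marked synchronization places show that nobody is busy, so no token is owed and `com`
  -- becomes irrelevant.
  have hcur : ∀ i, cur i = none := by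
    intro i
    have := H.sync i (sync_mem_dataComp hl hall i)
    rw [sp_sync] at this
    by_contra h
    simp [h] at this
  have : abstraction hl hall (sp N loops l M) cur com = M := by
    funext p
    rw [abstraction, if_neg (not_owes (hcur _))]
    rfl
  rwa [this] at hR

end Abstraction

/-! ### From the action based to the data driven composition -/

section Simulation

variable {N : (i : Fin n) → Net (P i) (T i) Λ} {loops : Prop} {l : List (Fin n)}

open Classical in
/-- The marking reached from `sp M` if the agents before `x` have begun their parts of `S` and
those before `y` have ended them. -/
noncomputable def midway (N : (i : Fin n) → Net (P i) (T i) Λ) (loops : Prop)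
    (l : List (Fin n)) (M : (actComp N).Marking) (S : Vec T) (x y : ℕ) :
    (dataComp N loops l).Marking
  | ⟨.base i p, h⟩ => M ⟨⟨i, p⟩, base_mem_places N loops l i p h⟩ -
      (if i.1 < x ∧ Consumes N S i p then 1 else 0) +
      if i.1 < y ∧ Produces N S i p then 1 else 0
  | ⟨.sync i, _⟩ => if S i ≠ none ∧ i.1 < x ∧ y ≤ i.1 then 0 else 1
  | ⟨.inn _ S' j, _⟩ => if S' = S ∧ j.1 < x ∧ y ≤ j.1 then 0 else 1
  | ⟨.out _ S' j, _⟩ => if S' = S ∧ j.1 < x ∧ y ≤ j.1 then 1 else 0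

variable {M : (actComp N).Marking} {S : Vec T} {x y : ℕ}

open Classical in
theorem midway_base {i : Fin n} {p : P i} (h : DPlace.base i p ∈ (dataComp N loops l).places) :
    midway N loops l M S x y ⟨.base i p, h⟩ = M ⟨⟨i, p⟩, base_mem_places N loops l i p h⟩ -
      (if i.1 < x ∧ Consumes N S i p then 1 else 0) +
      if i.1 < y ∧ Produces N S i p then 1 else 0 := rfl

open Classical in
theorem midway_sync {i : Fin n} (h : DPlace.sync i ∈ (dataComp N loops l).places) :
    midway N loops l M S x y ⟨.sync i, h⟩ = if S i ≠ none ∧ i.1 < x ∧ y ≤ i.1 then 0 else 1 := rfl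

open Classical in
theorem midway_val {b : Bool} {S' : Vec T} {i j : Fin n}
    (h : val b i S' j ∈ (dataComp N loops l).places) :
    midway N loops l M S x y ⟨val b i S' j, h⟩ =
      if (S' = S ∧ j.1 < x ∧ y ≤ j.1 ↔ b = true) then 1 else 0 := by
  cases b
  · change (if _ then 0 else 1) = _
    simp only [Bool.false_eq_true, iff_false, ite_not]
  · change (if _ then 1 else 0) = _
    simp only [iff_true]

theorem midway_zero_zero : midway N loops l M S 0 0 = sp N loops l M := by
  funext ⟨p, h⟩
  induction p using place_cases with
  | base i p => simp [midway_base, sp_base]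
  | sync i => simp [midway_sync, sp_sync]
  | var b k S' j => simp [midway_val, sp_val]

/-- The bounds of `midway` run over all agent numbers, so the numbers of agents not taking part in
`S` have to be skipped without a move. Such an agent has no variable for `S`. -/
theorem midway_begin_absent (j : Fin n) (hj : S j = none) (hl : l.Nodup)
    (hall : ∀ i, i ∈ l) : midway N loops l M S (j + 1) 0 = midway N loops l M S j 0 := by
  classical
  have hlt : ∀ i : Fin n, i ≠ j → (i.1 < j.1 + 1 ↔ i.1 < j.1) := fun i h => by
    have := Fin.val_ne_of_ne h
    omega
  funext ⟨p, h⟩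
  induction p using place_cases with
  | base i p =>
    by_cases hij : i = j
    · subst hij
      simp [midway_base, not_consumes hj]
    · simp [midway_base, hlt i hij]
  | sync i =>
    by_cases hij : i = j
    · subst hij
      simp [midway_sync, hj]
    · simp [midway_sync, hlt i hij]
  | var b k S' i =>
    obtain ⟨rfl, hv⟩ := (val_mem_dataComp hl hall).1 h
    by_cases hij : k = j
    · subst hij
      have : S' ≠ S := by
        rintro rfl
        exact hv.2 hj
      simp [midway_val, this]
    · simp [midway_val, hlt k hij]

theorem midway_end_absent (j : Fin n) (hj : S j = none) (hl : l.Nodup)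
    (hall : ∀ i, i ∈ l) : midway N loops l M S n (j + 1) = midway N loops l M S n j := by
  classical
  have hlt : ∀ i : Fin n, i ≠ j → (i.1 < j.1 + 1 ↔ i.1 < j.1) := fun i h => by
    have := Fin.val_ne_of_ne h
    omega
  have hle : ∀ i : Fin n, i ≠ j → (j.1 + 1 ≤ i.1 ↔ j.1 ≤ i.1) := fun i h => by
    have := Fin.val_ne_of_ne h
    omega
  funext ⟨p, h⟩
  induction p using place_cases with
  | base i p =>
    by_cases hij : i = j
    · subst hij
      simp [midway_base, not_produces hj]
    · simp [midway_base, hlt i hij]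
  | sync i =>
    by_cases hij : i = j
    · subst hij
      simp [midway_sync, hj]
    · simp only [midway_sync, hle i hij]
  | var b k S' i =>
    obtain ⟨rfl, hv⟩ := (val_mem_dataComp hl hall).1 h
    by_cases hij : k = j
    · subst hij
      have : S' ≠ S := by
        rintro rfl
        exact hv.2 hj
      simp [midway_val, this]
    · simp only [midway_val, hle k hij]

/-- At the turn of `j` exactly the agents of `S` below `j` are busy with it. The first agent thus
finds the last one idle, and any other finds its predecessor busy. -/
theorem midway_begin (hM : ∀ i p (h : p ∈ (N i).places), Consumes N S i p → 0 < M ⟨⟨i, p⟩, h⟩)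
    {j : Fin n} (hj : S j ≠ none) :
    VarMoves N loops l (midway N loops l M S j 0) false S j (midway N loops l M S (j + 1) 0) := by
  classical
  have hlt : ∀ i : Fin n, i ≠ j → (i.1 < j.1 + 1 ↔ i.1 < j.1) := fun i h => by
    have := Fin.val_ne_of_ne h
    omega
  refine ⟨fun _ p h hc => ?_, fun _ h => ?_, fun h => ?_, fun i hi h => ?_, fun i p h => ?_,
    fun i h => ?_, fun c i S' h => ?_⟩
  · simpa [midway_base] using hM j p _ hc
  · simp [midway_sync]
  · simp [midway_val]
  · rw [midway_val]
    by_cases hf : IsFirst S j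
    · have := hi.le_of_isFirst hf hj
      simp [hf, this]
    · have := (hi.lt_of_not_isFirst hj hf).1
      simp [hf, this]
  · by_cases hij : i = j
    · subst hij
      by_cases hc : Consumes N S i p
      · have := hM i p (base_mem_places N loops l i p h) hc
        simp [midway_base, hc]
        omega
      · simp [midway_base, hc]
    · simp [midway_base, hlt i hij, hij]
  · by_cases hij : i = j
    · subst hij
      simp [midway_sync, hj]
    · simp [midway_sync, hlt i hij, hij]
  · by_cases hij : i = j
    · subst hij
      by_cases hSS : S' = S <;> cases c <;> simp [midway_val, hSS]
    · simp [midway_val, hlt i hij, hij]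

/-- At the turn of `j` the agents of `S` from `j` on are still busy. The first agent finds the last
one busy, and any other finds its predecessor done. -/
theorem midway_end {j : Fin n} (hj : S j ≠ none) :
    VarMoves N loops l (midway N loops l M S n j) true S j (midway N loops l M S n (j + 1)) := by
  classical
  have hlt : ∀ i : Fin n, i ≠ j → (i.1 < j.1 + 1 ↔ i.1 < j.1) := fun i h => by
    have := Fin.val_ne_of_ne h
    omega
  have hle : ∀ i : Fin n, i ≠ j → (j.1 + 1 ≤ i.1 ↔ j.1 ≤ i.1) := fun i h => by
    have := Fin.val_ne_of_ne h
    omega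
  refine ⟨by simp, by simp, fun h => ?_, fun i hi h => ?_, fun i p h => ?_,
    fun i h => ?_, fun c i S' h => ?_⟩
  · simp [midway_val]
  · rw [midway_val]
    by_cases hf : IsFirst S j
    · have := hi.le_of_isFirst hf hj
      simp [hf, this]
    · have := (hi.lt_of_not_isFirst hj hf).1
      simp [hf, this]
  · by_cases hij : i = j
    · subst hij
      simp [midway_base]
    · simp [midway_base, hlt i hij, hij]
  · by_cases hij : i = j
    · subst hij
      simp [midway_sync, hj]
    · simp only [midway_sync, hle i hij]
      simp [hij]
  · by_cases hij : i = j
    · subst hij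
      by_cases hSS : S' = S <;> cases c <;> simp [midway_val, hSS]
    · simp only [midway_val, hle i hij]
      simp [hij]

theorem midway_full (hN : ∀ i, (N i).IsAgent) {M' : (actComp N).Marking}
    (hF : (actComp N).Fires M S M') : midway N loops l M S n n = sp N loops l M' := by
  classical
  obtain ⟨-, hM, hF⟩ := (actComp_fires_iff hN M S M').1 hF
  funext ⟨p, h⟩
  induction p using place_cases with
  | base i p =>
    have hp := base_mem_places N loops l i p h
    have := hF i p hp
    have hpos := hM i p hp
    rw [midway_base, sp_base]
    by_cases hc : Consumes N S i p <;> by_cases hpr : Produces N S i p <;>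
      simp [hc, hpr] at this hpos ⊢ <;> omega
  | sync i => simp [midway_sync, sp_sync]
  | var b k S' j => simp [midway_val, sp_val, not_le.2 j.2]

/-- One step of the action based composition is simulated by the data driven composition. -/
theorem sp_reaches (hN : ∀ i, (N i).IsAgent) (hl : l.Nodup) (hall : ∀ i, i ∈ l)
    {M' : (actComp N).Marking} (hF : (actComp N).Fires M S M') :
    Relation.ReflTransGen (fun m₁ m₂ => ∃ t, (dataComp N loops l).Fires m₁ t m₂)
      (sp N loops l M) (sp N loops l M') := by
  obtain ⟨hS, hM, hT⟩ := (actComp_fires_iff hN M S M').1 hF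
  rcases mem_trans_cases hS with hS | ⟨j, t, ht, hs, rfl⟩
  · have hbegin : ∀ x ≤ n, Relation.ReflTransGen
        (fun m₁ m₂ => ∃ t, (dataComp N loops l).Fires m₁ t m₂)
        (sp N loops l M) (midway N loops l M S x 0) := by
      intro x
      induction x with
      | zero => exact fun _ => midway_zero_zero ▸ .refl
      | succ x ih =>
        intro hx
        have ih := ih (by omega)
        by_cases hj : S ⟨x, hx⟩ = none
        · rwa [midway_begin_absent ⟨x, hx⟩ hj hl hall]
        · exact ih.tail ((exists_fires_iff_moves hl hall).2
            (.inr ⟨false, S, ⟨x, hx⟩, hS.hasVar hj, midway_begin hM hj⟩))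
    have hend : ∀ y ≤ n, Relation.ReflTransGen
        (fun m₁ m₂ => ∃ t, (dataComp N loops l).Fires m₁ t m₂)
        (sp N loops l M) (midway N loops l M S n y) := by
      intro y
      induction y with
      | zero => exact fun _ => hbegin n le_rfl
      | succ y ih =>
        intro hy
        have ih := ih (by omega)
        by_cases hj : S ⟨y, hy⟩ = none
        · rwa [midway_end_absent ⟨y, hy⟩ hj hl hall]
        · exact ih.tail ((exists_fires_iff_moves hl hall).2
            (.inr ⟨true, S, ⟨y, hy⟩, hS.hasVar hj, midway_end hj⟩))
    exact midway_full (loops := loops) (l := l) hN hF ▸ hend n le_rfl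
  · refine .single ((exists_fires_iff_moves hl hall).2 (.inl ⟨j, t, ht, hs, ?_⟩))
    -- In $sp(M)$ every synchronization place is marked, so the optional self-loop is no obstacle.
    refine ⟨fun i p h => hM i p _, fun _ _ => Nat.one_pos, fun i p h => hT i p _, fun _ _ => rfl,
      fun c i S' h => ?_⟩
    rw [sp_val, sp_val]

theorem reachable_sp (hN : ∀ i, (N i).IsAgent) (hl : l.Nodup) (hall : ∀ i, i ∈ l)
    (h : (actComp N).Reachable M) : (dataComp N loops l).Reachable (sp N loops l M) := by
  induction h with
  | refl =>
    rw [sp_m0 hl]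
    exact .refl
  | tail _ hstep ih =>
    obtain ⟨S, hS⟩ := hstep
    exact ih.trans (sp_reaches hN hl hall hS)

end Simulation

end MAS

theorem theorem2 {n : ℕ} {P : Fin n → Type u} {T : Fin n → Type v} {Λ : Type w}
    (N : (i : Fin n) → Net (P i) (T i) Λ) (hN : ∀ i, (N i).IsAgent)
    (loops : Prop) (l : List (Fin n)) (hl : l.Nodup) (hall : ∀ i, i ∈ l)
    (M : (MAS.actComp N).Marking) :
    (MAS.actComp N).Reachable M ↔
      (MAS.dataComp N loops l).Reachable (MAS.sp N loops l M) :=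
  ⟨MAS.reachable_sp hN hl hall, MAS.reachable_of_reachable_sp hN hl hall⟩
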